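/- Let ${\sf X}={\sf X}_u\times{\sf X}_n$ be a product of two finite sets, ${\cal U}:{\sf X}\to\mathbb R$ a function, and $x^\circ\in{\sf X}$ a fixed state. A decision rule is a matrix $R(x,x_u')\ge 0$ ($x\in{\sf X}$, $x'_u\in{\sf X}_u$) whose rows sum to one. Let $R_0$ be a decision rule (nominal behaviour) and $Q_0(x,x_n')\ge0$ ($x\in{\sf X}$, $x'_n\in{\sf X}_n$) a matrix whose rows sum to one (nature). For a decision rule $R$ write $P_R(x,x')=R(x,x_u')Q_0(x,x_n')$, where $x'=(x'_u,x'_n)$; assume that $P_0:=P_{R_0}$ is irreducible and aperiodic. For $\zeta\in\mathbb R$ let $w_\zeta(x,R)=\zeta\,{\cal U}(x)-D(P_R(x,\cdot)\|P_0(x,\cdot))$, where $D(\mu\|\nu)=\sum_a\mu(a)\log(\mu(a)/\nu(a))$ is relative entropy ($0\log 0=0$, and $D=+\infty$ if $\mu\not\ll\nu$). Let $$\eta^*(\zeta)=\max\ \liminf_{T\to\infty}\frac1T\sum_{t=0}^{T-1}{\sf E}_x[w_\zeta(X(t),R(t))],$$ the maximum being over all policies in which the decision rule $R(t)$ is a function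 of $X(0),\dots,X(t)$, and $X(t+1)$ has conditional law $P_{R(t)}(X(t),\cdot)$; the maximum does not depend on the initial state $x$. The relative value function $h^*_\zeta:{\sf X}\to\mathbb R$ is the solution with $h^*_\zeta(x^\circ)=0$ of the average-reward optimality equation $$\max_R\Bigl\{w_\zeta(x,R)+\sum_{x'}P_R(x,x')h^*_\zeta(x')\Bigr\}=h^*_\zeta(x)+\eta^*(\zeta),\qquad x\in{\sf X}.$$ Let $\check P_\zeta$ be the optimal transition matrix, that is, the $P$-component of a maximizer $(\pi,P)$ of $\zeta\sum_x\pi(x){\cal U}(x)-\sum_x\pi(x)D(P(x,\cdot)\|P_0(x,\cdot))$ over all pairs of a probability mass function $\pi$ and a matrix $P=P_R$ ($R$ a decision rule) with $\pi P=\pi$. For $h:{\sf X}\to\mathbb R$ put $h(x_u'\mid x)=\sum_{x_n'}Q_0(x,x_n')h(x_u',x_n')$ and $$P_h(x,x')=P_0(x,x')\exp\bigl(h(x_u'\mid x)-\Lambda_h(x)\bigr),\qquad \Lambda_h(x)=\log\sum_{x'}P_0(x,x')\exp\bigl(h(x_u'\mid x)\bigr).$$ For an irreducible and aperiodic transition matrix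 $P$ with invariant probability mass function $\pi$ let $Z=[I-P+1\otimes\pi]^{-1}$, where every row of $1\otimes\pi$ is $\pi$, and $${\cal H}^\circ(P)(x)=\sum_{x'}[Z(x,x')-Z(x^\circ,x')]\,{\cal U}(x').$$ Let ${\cal V}(h)={\cal H}^\circ(P_h)$. Theorem. (a) For every $h:{\sf X}\to\mathbb R$, $P_h$ is an irreducible and aperiodic transition matrix, with a unique invariant probability mass function $\pi$, and $I-P_h+1\otimes\pi$ is invertible; thus ${\cal V}$ is well defined. (b) The ODE $\frac{d}{d\zeta}h^\circ_\zeta={\cal V}(h^\circ_\zeta)$, $\zeta\in\mathbb R$, with $h^\circ_0\equiv0$, has exactly one solution on $\mathbb R$. (c) For every $\zeta\in\mathbb R$, the relative value function $h^*_\zeta$ exists, is unique, and $h^\circ_\zeta=h^*_\zeta$. (d) Consequently, for every $\zeta\in\mathbb R$, the optimal transition matrix exists, is unique, and $\check P_\zeta=P_{h^\circ_\zeta}$. It is $P_R$ for a decision rule $R$ whose stationary policy attains $\eta^*(\zeta)$ from every initial state, and a decision rule $R$ attains the maximum in the optimality equation at every $x$ if and only if $P_R=P_{h^\circ_\zeta}$.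 -/

import Mathlib

open scoped BigOperators Matrix

noncomputable section

namespace KLMDP

section Chains

variable {α β : Type*} [Fintype α] [Fintype β]

/-- Every row is a probability mass function. -/
def IsKernel (P : Matrix α β ℝ) : Prop :=
  ∀ x, P x ∈ stdSimplex ℝ β

/-- The gcd of the possible return times is one, at every state. -/
def IsAperiodic [DecidableEq α] (P : Matrix α α ℝ) : Prop :=
  ∀ x, ∀ d : ℕ, (∀ n : ℕ, 0 < n → 0 < (P ^ n) x x → d ∣ n) → d = 1

/-- `π` is an invariant probability mass function of `P`. -/
def IsInvariantPmf (π : α → ℝ) (P : Matrix α α ℝ) : Prop :=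
  π ∈ stdSimplex ℝ α ∧ π ᵥ* P = π

/-- The invariant pmf of `P` (meaningful when there is exactly one). -/
def invariantPmf (P : Matrix α α ℝ) : α → ℝ :=
  Classical.epsilon fun π => IsInvariantPmf π P

/-- The matrix `I - P + 1 ⊗ π`, with `π` the invariant pmf of `P`. -/
def preFundamental [DecidableEq α] (P : Matrix α α ℝ) : Matrix α α ℝ :=
  1 - P + Matrix.of fun _ x' => invariantPmf P x'

/-- The fundamental matrix `Z = [I - P + 1 ⊗ π]⁻¹`. -/
def fundamentalMatrix [DecidableEq α] (P : Matrix α α ℝ) : Matrix α α ℝ :=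
  (preFundamental P)⁻¹

/-- Relative entropy `D(μ‖ν)` of two pmfs on a finite set, with `0 log 0 = 0` and value `+∞`
when `μ` is not absolutely continuous with respect to `ν`. -/
def relEntropy (μ ν : α → ℝ) : EReal :=
  open Classical in
  if ∀ a, ν a = 0 → μ a = 0 then ((∑ a, μ a * Real.log (μ a / ν a) : ℝ) : EReal) else ⊤

end Chains

variable {Xu Xn : Type*} [Fintype Xu] [Fintype Xn] [DecidableEq Xu] [DecidableEq Xn]

/-- The transition matrix `P(x, x') = R(x, x'_u) Q(x, x'_n)`. -/
def transition (R : Matrix (Xu × Xn) Xu ℝ) (Q : Matrix (Xu × Xn) Xn ℝ) :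
    Matrix (Xu × Xn) (Xu × Xn) ℝ :=
  Matrix.of fun x x' => R x x'.1 * Q x x'.2

/-- The data of the decision problem: the nominal decision rule `R₀`, nature's kernel `Q₀`, the
utility function `U` and the reference state `x₀`.  The nominal transition matrix is irreducible
and aperiodic. -/
structure Model (Xu Xn : Type*) [Fintype Xu] [Fintype Xn] [DecidableEq Xu] [DecidableEq Xn] where
  R₀ : Matrix (Xu × Xn) Xu ℝ
  Q₀ : Matrix (Xu × Xn) Xn ℝ
  U : Xu × Xn → ℝ
  x₀ : Xu × Xn
  kernel_R₀ : IsKernel R₀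
  kernel_Q₀ : IsKernel Q₀
  irreducible : (transition R₀ Q₀).IsIrreducible
  aperiodic : IsAperiodic (transition R₀ Q₀)

namespace Model

variable (M : Model Xu Xn)

/-- The transition matrix induced by the decision rule `R`. -/
def P (R : Matrix (Xu × Xn) Xu ℝ) : Matrix (Xu × Xn) (Xu × Xn) ℝ :=
  transition R M.Q₀

/-- The nominal transition matrix. -/
def P₀ : Matrix (Xu × Xn) (Xu × Xn) ℝ := M.P M.R₀

/-! ### Exponential tilting and the vector field -/

/-- The log moment generating function `Λ_g(x) = log ∑ x', P₀(x, x') exp (g(x' ∣ x))`. -/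
def logMGF (g : Xu × Xn → Xu × Xn → ℝ) (x : Xu × Xn) : ℝ :=
  Real.log (∑ x', M.P₀ x x' * Real.exp (g x x'))

/-- The tilted matrix `P_g(x, x') = P₀(x, x') exp (g(x' ∣ x) - Λ_g(x))`. -/
def tilt (g : Xu × Xn → Xu × Xn → ℝ) : Matrix (Xu × Xn) (Xu × Xn) ℝ :=
  Matrix.of fun x x' => M.P₀ x x' * Real.exp (g x x' - M.logMGF g x)

/-- The conditional expectation `h(x'_u ∣ x) = ∑ x'_n, Q₀(x, x'_n) h(x'_u, x'_n)`, as a function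
of `x` and `x'`. -/
def condMean (h : Xu × Xn → ℝ) (x x' : Xu × Xn) : ℝ :=
  ∑ n, M.Q₀ x n * h (x'.1, n)

/-- The transition matrix `P_h`. -/
def Ph (h : Xu × Xn → ℝ) : Matrix (Xu × Xn) (Xu × Xn) ℝ :=
  M.tilt (M.condMean h)

/-- The functional `ℋ°(P)(x) = ∑ x', [Z(x, x') - Z(x₀, x')] U(x')`. -/
def poissonSol (P : Matrix (Xu × Xn) (Xu × Xn) ℝ) (x : Xu × Xn) : ℝ :=
  ∑ x', (fundamentalMatrix P x x' - fundamentalMatrix P M.x₀ x') * M.U x'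

/-- The vector field `𝒱(h) = ℋ°(P_h)`. -/
def vectorField (h : Xu × Xn → ℝ) : Xu × Xn → ℝ :=
  M.poissonSol (M.Ph h)

/-- `h` solves the ODE `d/dζ h_ζ = 𝒱(h_ζ)`, `ζ ∈ ℝ`, with `h_0 ≡ 0`. -/
def SolvesODE (h : ℝ → Xu × Xn → ℝ) : Prop :=
  h 0 = 0 ∧ ∀ ζ : ℝ, HasDerivAt h (M.vectorField (h ζ)) ζ

/-! ### The average-reward problem -/

/-- The one-step reward `w(x, R) = ζ U(x) - D(P(x, ·)‖P₀(x, ·))`. -/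
def reward (ζ : ℝ) (x : Xu × Xn) (R : Matrix (Xu × Xn) Xu ℝ) : EReal :=
  ((ζ * M.U x : ℝ) : EReal) - relEntropy (M.P R x) (M.P₀ x)

end Model

/-- An admissible policy selects the decision rule `R(t)` at time `t` as a function of the observed
states `X(0), …, X(t)`. -/
structure Policy (Xu Xn : Type*) [Fintype Xu] [Fintype Xn] where
  rule : (t : ℕ) → (Fin (t + 1) → Xu × Xn) → Matrix (Xu × Xn) Xu ℝ
  kernel_rule : ∀ t ω, IsKernel (rule t ω)

/-- The policy that uses the same decision rule at all times. -/
def Policy.stationary (R : Matrix (Xu × Xn) Xu ℝ) (hR : IsKernel R) : Policy Xu Xn where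
  rule _ _ := R
  kernel_rule _ _ := hR

namespace Model

variable (M : Model Xu Xn)

/-- The probability that `(X(0), …, X(t)) = ω` under the policy `φ`, when `X(0) = x`. -/
def pathProb (φ : Policy Xu Xn) (x : Xu × Xn) : (t : ℕ) → (Fin (t + 1) → Xu × Xn) → ℝ
  | 0, ω => if ω 0 = x then 1 else 0
  | t + 1, ω => pathProb φ x t (Fin.init ω) *
      M.P (φ.rule t (Fin.init ω)) (ω (Fin.last t).castSucc) (ω (Fin.last (t + 1)))

/-- The expected reward `E_x[w(X(t), R(t))]` under the policy `φ`. -/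
def expectedReward (ζ : ℝ) (φ : Policy Xu Xn) (x : Xu × Xn) (t : ℕ) : EReal :=
  ∑ ω : Fin (t + 1) → Xu × Xn,
    (M.pathProb φ x t ω : EReal) * M.reward ζ (ω (Fin.last t)) (φ.rule t ω)

/-- The long-run average reward `liminf_T (1/T) ∑_{t < T} E_x[w(X(t), R(t))]`. -/
def averageReward (ζ : ℝ) (φ : Policy Xu Xn) (x : Xu × Xn) : EReal :=
  Filter.liminf
    (fun T : ℕ => ((1 / (T : ℝ) : ℝ) : EReal) * ∑ t ∈ Finset.range T, M.expectedReward ζ φ x t)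
    Filter.atTop

/-- `η` is the optimal average reward: the maximum over all policies, from every initial state. -/
def IsOptimalReward (ζ η : ℝ) : Prop :=
  ∀ x, IsGreatest (Set.range fun φ : Policy Xu Xn => M.averageReward ζ φ x) (η : EReal)

/-- The quantity `w(x, R) + ∑ x', P(x, x') h(x')` maximized in the optimality equation. -/
def bellman (ζ : ℝ) (h : Xu × Xn → ℝ) (x : Xu × Xn) (R : Matrix (Xu × Xn) Xu ℝ) : EReal :=
  M.reward ζ x R + ((∑ x', M.P R x x' * h x' : ℝ) : EReal)

/-- The average-reward optimality equation
`max_R {w(x, R) + ∑ x', P(x, x') h(x')} = h(x) + η` for all `x`. -/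
def SolvesAROE (ζ : ℝ) (h : Xu × Xn → ℝ) (η : ℝ) : Prop :=
  ∀ x, IsGreatest (M.bellman ζ h x '' {R | IsKernel R}) ((h x + η : ℝ) : EReal)

/-- `h` is a relative value function for the parameter `ζ`, normalized by `h(x₀) = 0`: it solves
the optimality equation together with the optimal average reward. -/
def IsRelativeValueFunction (ζ : ℝ) (h : Xu × Xn → ℝ) : Prop :=
  h M.x₀ = 0 ∧ ∃ η : ℝ, M.IsOptimalReward ζ η ∧ M.SolvesAROE ζ h η

/-- The Donsker-Varadhan rate `K(P‖P₀) = ∑ x, π(x) D(P(x, ·)‖P₀(x, ·))`. -/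
def dvRate (π : Xu × Xn → ℝ) (P : Matrix (Xu × Xn) (Xu × Xn) ℝ) : EReal :=
  ∑ x, (π x : EReal) * relEntropy (P x) (M.P₀ x)

/-- The pairs `(π, P)` with `P` a transition matrix that respects nature and `π P = π`. -/
def feasible : Set ((Xu × Xn → ℝ) × Matrix (Xu × Xn) (Xu × Xn) ℝ) :=
  {p | (∃ R, IsKernel R ∧ p.2 = M.P R) ∧ IsInvariantPmf p.1 p.2}

/-- `P` is an optimal transition matrix: for some `π`, the pair `(π, P)` maximizes
`ζ π(U) - K(P‖P₀)` over all feasible pairs. -/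
def IsOptimalTransition (ζ : ℝ) (P : Matrix (Xu × Xn) (Xu × Xn) ℝ) : Prop :=
  ∃ π, (π, P) ∈ M.feasible ∧
    IsMaxOn (fun p : (Xu × Xn → ℝ) × Matrix (Xu × Xn) (Xu × Xn) ℝ =>
      ((ζ * ∑ x, p.1 x * M.U x : ℝ) : EReal) - M.dvRate p.1 p.2) M.feasible (π, P)

end Model

end KLMDP

end

namespace KLMDP

/-! ### Irreducible kernels on a finite set: maximum principle, invariant pmf, fundamental matrix.
-/

section Chains

/-! Since nature's factor is fixed, `∑ P_R h` equals the `P_R`-mean of `h(x'_u ∣ x)`. The Gibbs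
variational principle (`relEntropy_gibbs`) then evaluates the maximum in the optimality equation as
`ζ U + Λ_h`, attained exactly at `P_R = P_h`. The optimality equation becomes the real equation `ζ U
+ Λ_h = h + η` (`SolvesLogEq`).

Storing `η` as the value at `x₀` turns this into `F(θ) = ζ U`, where `F(θ) = θ - Λ_θ + θ(x₀)` is
`logEqMap`. Convexity of `Λ` and the maximum principle make `F` injective (`SolvesLogEq.unique`).
Its derivative `g ↦ g - P_θ g + g(x₀)` is invertible, so `F` is open; an a priori bound makes it
proper. Hence `F` is a bijection with differentiable inverse, for all `ζ` at once.

Differentiating `F(θ_ζ) = ζ U` gives the Poisson equation for `P_θ`, whose normalized solution is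
the vector field, so the relative value function solves the ODE. Conversely, along any solution of
the ODE, `h - Λ_h - ζ U` remains constant in `x`; the solution therefore satisfies the optimality
equation, which has only one normalized solution. Uniqueness thus needs no Lipschitz estimate.

Optimality follows by verification: the Gibbs inequality bounds each reward by `η` plus an increment
of `h`, which telescopes along policies and integrates to zero against invariant pmfs. -/

theorem IsKernel.nonneg {α β : Type*} [Fintype β] {P : Matrix α β ℝ} (hP : IsKernel P) (x : α)
    (y : β) : 0 ≤ P x y := (hP x).1 y

theorem IsKernel.sum_eq_one {α β : Type*} [Fintype β] {P : Matrix α β ℝ} (hP : IsKernel P)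
    (x : α) : ∑ y, P x y = 1 := (hP x).2

variable {α : Type*} [Fintype α]

theorem IsKernel.sum_mul_const {P : Matrix α α ℝ} (hP : IsKernel P) (x : α) (c : ℝ) :
    ∑ y, P x y * c = c := by
  rw [← Finset.sum_mul, hP.sum_eq_one, one_mul]

theorem sum_mulVec_of_invariant {P : Matrix α α ℝ} {π : α → ℝ} (hπ : π ᵥ* P = π) (d : α → ℝ) :
    ∑ x, π x * ∑ y, P x y * d y = ∑ y, π y * d y := by
  have h : π ⬝ᵥ (P *ᵥ d) = π ⬝ᵥ d := by rw [Matrix.dotProduct_mulVec, hπ]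
  exact h

/-- The triangle inequality gives `|v| ≤ |v| P` entrywise. Both sides have the same total mass, so
every inequality is an equality. -/
theorem abs_vecMul_eq {P : Matrix α α ℝ} (hP : IsKernel P) {v : α → ℝ} (hv : v ᵥ* P = v) :
    (fun x => |v x|) ᵥ* P = fun x => |v x| := by
  have hle : ∀ y, |v y| ≤ ∑ x, |v x| * P x y := fun y => by
    conv_lhs => rw [← hv]
    refine (Finset.abs_sum_le_sum_abs _ _).trans (Finset.sum_le_sum fun x _ => ?_)
    rw [abs_mul, abs_of_nonneg (hP.nonneg x y)]
  have hsum : ∑ y, |v y| = ∑ y, ∑ x, |v x| * P x y := by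
    rw [Finset.sum_comm]
    simp_rw [← Finset.mul_sum, hP.sum_eq_one, mul_one]
  have := (Finset.sum_eq_sum_iff_of_le fun y _ => hle y).1 hsum
  funext y
  exact (this y (Finset.mem_univ y)).symm

variable [DecidableEq α]

theorem pow_nonneg_of_kernel {P : Matrix α α ℝ} (hP : IsKernel P) (n : ℕ) (x y : α) :
    0 ≤ (P ^ n) x y :=
  Matrix.pow_apply_nonneg hP.nonneg n x y

theorem IsKernel.pow {P : Matrix α α ℝ} (hP : IsKernel P) (n : ℕ) : IsKernel (P ^ n) := by
  intro x
  refine ⟨pow_nonneg_of_kernel hP n x, ?_⟩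
  induction n generalizing x with
  | zero => simp [Matrix.one_apply]
  | succ k ih =>
    simp only [pow_succ, Matrix.mul_apply]
    rw [Finset.sum_comm]
    simp_rw [← Finset.mul_sum, hP.sum_eq_one, mul_one]
    exact ih x

theorem exists_pow_pos {P : Matrix α α ℝ} (hI : P.IsIrreducible) (x y : α) :
    ∃ k > 0, 0 < (P ^ k) x y :=
  (Matrix.isIrreducible_iff_exists_pow_pos hI.nonneg).1 hI x y

theorem le_pow_mulVec {P : Matrix α α ℝ} (hP : IsKernel P) {d : α → ℝ}
    (hd : ∀ x, d x ≤ ∑ y, P x y * d y) (n : ℕ) (x : α) : d x ≤ ∑ y, (P ^ n) x y * d y := by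
  induction n generalizing x with
  | zero => simp [Matrix.one_apply]
  | succ k ih =>
    calc d x ≤ ∑ y, P x y * d y := hd x
      _ ≤ ∑ y, P x y * ∑ z, (P ^ k) y z * d z :=
        Finset.sum_le_sum fun y _ => mul_le_mul_of_nonneg_left (ih y) (hP.nonneg x y)
      _ = ∑ z, (P ^ (k + 1)) x z * d z := by
        simp only [pow_succ', Matrix.mul_apply, Finset.mul_sum, Finset.sum_mul, mul_assoc]
        exact Finset.sum_comm

/-- The maximum principle: a subharmonic function of an irreducible kernel is constant. -/
theorem eq_of_subharmonic {P : Matrix α α ℝ} (hP : IsKernel P) (hI : P.IsIrreducible)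
    {d : α → ℝ} (hd : ∀ x, d x ≤ ∑ y, P x y * d y) (x y : α) : d x = d y := by
  have : Nonempty α := ⟨x⟩
  obtain ⟨m, hm⟩ := Finite.exists_max d
  suffices h : ∀ z, d z = d m by rw [h x, h y]
  intro z
  obtain ⟨k, -, hk⟩ := exists_pow_pos hI m z
  by_contra hne
  have hlt : d z < d m := lt_of_le_of_ne (hm z) hne
  have h1 := le_pow_mulVec hP hd k m
  have h2 : ∑ y, (P ^ k) m y * d y < ∑ y, (P ^ k) m y * d m :=
    Finset.sum_lt_sum
      (fun y _ => mul_le_mul_of_nonneg_left (hm y) (pow_nonneg_of_kernel hP k m y))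
      ⟨z, Finset.mem_univ _, mul_lt_mul_of_pos_left hlt hk⟩
  rw [(hP.pow k).sum_mul_const] at h2
  linarith

theorem vecMul_pow_eq {P : Matrix α α ℝ} {w : α → ℝ} (hw : w ᵥ* P = w) (n : ℕ) :
    w ᵥ* P ^ n = w := by
  induction n with
  | zero => simp
  | succ k ih => rw [pow_succ', ← Matrix.vecMul_vecMul, hw, ih]

theorem pos_of_vecMul_eq {P : Matrix α α ℝ} (hP : IsKernel P) (hI : P.IsIrreducible)
    {w : α → ℝ} (hw0 : ∀ x, 0 ≤ w x) (hw : w ᵥ* P = w) {x : α} (hx : 0 < w x) (y : α) :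
    0 < w y := by
  obtain ⟨k, -, hk⟩ := exists_pow_pos hI x y
  rw [← vecMul_pow_eq hw k]
  exact Finset.sum_pos' (fun i _ => mul_nonneg (hw0 i) (pow_nonneg_of_kernel hP k i y))
    ⟨x, Finset.mem_univ _, mul_pos hx hk⟩

theorem IsInvariantPmf.pos {P : Matrix α α ℝ} {π : α → ℝ} (hπ : IsInvariantPmf π P)
    (hP : IsKernel P) (hI : P.IsIrreducible) (x : α) : 0 < π x := by
  obtain ⟨z, -, hz⟩ : ∃ z ∈ Finset.univ, 0 < π z := by
    by_contra! h
    have := Finset.sum_nonpos h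
    rw [hπ.1.2] at this
    linarith
  exact pos_of_vecMul_eq hP hI hπ.1.1 hπ.2 hz x

/-- `|d| + d`, with `d = π - π'`, is nonnegative and invariant. If it is positive at one state it is
positive at all, so `π > π'` everywhere, contradicting equal masses. -/
theorem IsInvariantPmf.le {P : Matrix α α ℝ} {π π' : α → ℝ} (hπ : IsInvariantPmf π P)
    (hπ' : IsInvariantPmf π' P) (hP : IsKernel P) (hI : P.IsIrreducible) (x : α) :
    π x ≤ π' x := by
  by_contra! hx
  have hd : (π - π') ᵥ* P = π - π' := by rw [Matrix.sub_vecMul, hπ.2, hπ'.2]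
  have hlt : ∀ z, π' z < π z := fun z => by
    have h := pos_of_vecMul_eq hP hI (w := (fun z => |(π - π') z|) + (π - π'))
      (fun z => by simpa using neg_le_iff_add_nonneg'.1 (neg_abs_le _))
      (by rw [Matrix.add_vecMul, abs_vecMul_eq hP hd, hd]) (x := x)
      (by
        simp only [Pi.add_apply, Pi.sub_apply]
        linarith [abs_nonneg (π x - π' x)]) z
    simp only [Pi.add_apply, Pi.sub_apply] at h
    by_contra! hz
    rw [abs_of_nonpos (by linarith)] at h
    linarith
  have := Finset.sum_lt_sum_of_nonempty ⟨x, Finset.mem_univ x⟩ fun z _ => hlt z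
  rw [hπ.1.2, hπ'.1.2] at this
  exact lt_irrefl _ this

/-- Constants lie in the right kernel of `1 - P`, so there is a nonzero left null vector; its
normalized absolute value is the pmf. -/
theorem existsUnique_invariantPmf [Nonempty α] {P : Matrix α α ℝ} (hP : IsKernel P)
    (hI : P.IsIrreducible) : ∃! π, IsInvariantPmf π P := by
  have hdet : (1 - P).det = 0 := by
    rw [← Matrix.exists_mulVec_eq_zero_iff]
    refine ⟨fun _ => 1, fun h => one_ne_zero (congrFun h (Classical.arbitrary α)), ?_⟩
    rw [Matrix.sub_mulVec, Matrix.one_mulVec, sub_eq_zero]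
    funext x
    simpa [Matrix.mulVec, dotProduct] using (hP.sum_eq_one x).symm
  obtain ⟨v, hv0, hv⟩ := Matrix.exists_vecMul_eq_zero_iff.2 hdet
  rw [Matrix.vecMul_sub, Matrix.vecMul_one, sub_eq_zero] at hv
  obtain ⟨a, ha⟩ := Function.ne_iff.1 hv0
  have hpos : 0 < ∑ x, |v x| :=
    Finset.sum_pos' (fun x _ => abs_nonneg _) ⟨a, Finset.mem_univ _, abs_pos.2 ha⟩
  refine existsUnique_of_exists_of_unique
    ⟨(∑ x, |v x|)⁻¹ • fun x => |v x|, ⟨fun x => ?_, ?_⟩, ?_⟩ fun π π' hπ hπ' =>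
      funext fun x => le_antisymm (hπ.le hπ' hP hI x) (hπ'.le hπ hP hI x)
  · exact mul_nonneg (inv_nonneg.2 hpos.le) (abs_nonneg _)
  · simp only [Pi.smul_apply, smul_eq_mul]
    rw [← Finset.mul_sum, inv_mul_cancel₀ hpos.ne']
  · rw [Matrix.smul_vecMul, abs_vecMul_eq hP hv.symm]

theorem isInvariantPmf_invariantPmf [Nonempty α] {P : Matrix α α ℝ} (hP : IsKernel P)
    (hI : P.IsIrreducible) : IsInvariantPmf (invariantPmf P) P :=
  Classical.epsilon_spec (existsUnique_invariantPmf hP hI).exists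

/-- If `d - P d` is a constant, then the constant vanishes and `d` is itself a constant. -/
theorem eq_of_sub_mulVec_const [Nonempty α] {P : Matrix α α ℝ} (hP : IsKernel P) (hI : P.IsIrreducible)
    {d : α → ℝ} {c : ℝ} (hd : ∀ x, d x - ∑ y, P x y * d y = c) :
    c = 0 ∧ ∀ x y, d x = d y := by
  obtain ⟨π, hπ, -⟩ := existsUnique_invariantPmf hP hI
  have h1 : ∑ x, π x * (d x - ∑ y, P x y * d y) = 0 := by
    simp_rw [mul_sub]
    rw [Finset.sum_sub_distrib, sum_mulVec_of_invariant hπ.2, sub_self]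
  simp_rw [hd, ← Finset.sum_mul] at h1
  rw [hπ.1.2, one_mul] at h1
  refine ⟨h1, eq_of_subharmonic hP hI fun x => ?_⟩
  linarith [hd x]

/-- A null vector `g` satisfies `g - P g = -π(g)`, a constant. So `π(g) = 0` and `g` is constant,
hence zero. -/
theorem isUnit_preFundamental [Nonempty α] {P : Matrix α α ℝ} (hP : IsKernel P)
    (hI : P.IsIrreducible) : IsUnit (preFundamental P) := by
  rw [Matrix.isUnit_iff_isUnit_det, isUnit_iff_ne_zero]
  intro hdet
  obtain ⟨g, hg0, hg⟩ := Matrix.exists_mulVec_eq_zero_iff.2 hdet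
  have hπ := isInvariantPmf_invariantPmf hP hI
  rw [preFundamental, Matrix.add_mulVec, Matrix.sub_mulVec, Matrix.one_mulVec] at hg
  have hg' : ∀ x, g x - ∑ y, P x y * g y = -∑ y, invariantPmf P y * g y := fun x => by
    have := congrFun hg x
    simp only [Pi.add_apply, Pi.sub_apply, Matrix.mulVec, dotProduct, Matrix.of_apply,
      Pi.zero_apply] at this
    linarith
  obtain ⟨hc, hconst⟩ := eq_of_sub_mulVec_const hP hI hg'
  apply hg0
  funext x
  have : ∑ y, invariantPmf P y * g y = g x := by
    simp_rw [fun y => hconst y x, ← Finset.sum_mul]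
    rw [hπ.1.2, one_mul]
  simpa [this] using hc

theorem pow_pos_of_support_eq {P P' : Matrix α α ℝ} (hP : ∀ x y, 0 ≤ P x y)
    (hP' : ∀ x y, 0 ≤ P' x y) (h : ∀ x y, 0 < P x y → 0 < P' x y) (n : ℕ) (x y : α)
    (hn : 0 < (P ^ n) x y) : 0 < (P' ^ n) x y := by
  induction n generalizing y with
  | zero => simpa using hn
  | succ k ih =>
    rw [pow_succ, Matrix.mul_apply] at hn ⊢
    obtain ⟨z, -, hz⟩ := (Finset.sum_pos_iff_of_nonneg fun z _ =>
      mul_nonneg (Matrix.pow_apply_nonneg hP k x z) (hP z y)).1 hn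
    refine Finset.sum_pos' (fun z _ =>
      mul_nonneg (Matrix.pow_apply_nonneg hP' k x z) (hP' z y)) ⟨z, Finset.mem_univ _, ?_⟩
    have h1 : 0 < (P ^ k) x z := pos_of_mul_pos_left hz (hP z y)
    exact mul_pos (ih z h1) (h _ _ (pos_of_mul_pos_right hz h1.le))

theorem isIrreducible_of_support {P P' : Matrix α α ℝ} (hI : P.IsIrreducible)
    (hP' : ∀ x y, 0 ≤ P' x y) (h : ∀ x y, 0 < P x y → 0 < P' x y) : P'.IsIrreducible := by
  rw [Matrix.isIrreducible_iff_exists_pow_pos hP']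
  intro x y
  obtain ⟨k, hk, hpos⟩ := exists_pow_pos hI x y
  exact ⟨k, hk, pow_pos_of_support_eq hI.nonneg hP' h k x y hpos⟩

theorem isAperiodic_of_support {P P' : Matrix α α ℝ} (hA : IsAperiodic P)
    (hP : ∀ x y, 0 ≤ P x y) (hP' : ∀ x y, 0 ≤ P' x y) (h : ∀ x y, 0 < P x y → 0 < P' x y) :
    IsAperiodic P' := fun x d hd =>
  hA x d fun n hn hpos => hd n hn (pow_pos_of_support_eq hP hP' h n x x hpos)

/-- A nonnegative function with `P k ≤ k + c` that vanishes somewhere is bounded, uniformly in the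
function. -/
theorem exists_bound_of_mulVec_le {P : Matrix α α ℝ} (hP : IsKernel P) (hI : P.IsIrreducible)
    {c : ℝ} (hc : 0 ≤ c) :
    ∃ B : ℝ, ∀ k : α → ℝ, (∀ x, 0 ≤ k x) → (∀ x, ∑ y, P x y * k y ≤ k x + c) →
      ∀ x, k x = 0 → ∀ y, k y ≤ B := by
  have key : ∀ n : ℕ, ∀ k : α → ℝ, (∀ x, ∑ y, P x y * k y ≤ k x + c) →
      ∀ x, ∑ y, (P ^ n) x y * k y ≤ k x + n * c := by
    intro n k hk
    induction n with
    | zero => simp [Matrix.one_apply]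
    | succ m ih =>
      intro x
      calc ∑ z, (P ^ (m + 1)) x z * k z = ∑ y, P x y * ∑ z, (P ^ m) y z * k z := by
            simp only [pow_succ', Matrix.mul_apply, Finset.mul_sum, Finset.sum_mul, mul_assoc]
            exact Finset.sum_comm
        _ ≤ ∑ y, P x y * (k y + m * c) :=
          Finset.sum_le_sum fun y _ => mul_le_mul_of_nonneg_left (ih y) (hP.nonneg x y)
        _ = ∑ y, P x y * k y + m * c := by
          simp_rw [mul_add, Finset.sum_add_distrib]
          rw [hP.sum_mul_const]
        _ ≤ k x + (m + 1 : ℕ) * c := by push_cast; linarith [hk x]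
  choose N _ hN using exists_pow_pos hI
  -- For a single pair, `P^N(x, y) k(y) ≤ k(x) + N c = N c`; the sum over all pairs dominates each
  -- of these bounds.
  refine ⟨∑ x, ∑ y, N x y * c / (P ^ N x y) x y, fun k hk0 hk x hx y => ?_⟩
  have hnn : ∀ x y, 0 ≤ N x y * c / (P ^ N x y) x y := fun x y =>
    div_nonneg (mul_nonneg (Nat.cast_nonneg _) hc) (hN x y).le
  have h1 : k y ≤ N x y * c / (P ^ N x y) x y := by
    rw [le_div_iff₀ (hN x y), mul_comm]
    have h2 := key (N x y) k hk x
    rw [hx, zero_add] at h2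
    exact (Finset.single_le_sum (f := fun y' => (P ^ N x y) x y' * k y')
      (fun y' _ => mul_nonneg (pow_nonneg_of_kernel hP _ x y') (hk0 y'))
      (Finset.mem_univ y)).trans h2
  exact h1.trans ((Finset.single_le_sum (f := fun y => N x y * c / (P ^ N x y) x y)
    (fun y' _ => hnn x y') (Finset.mem_univ y)).trans
    (Finset.single_le_sum (f := fun x => ∑ y, N x y * c / (P ^ N x y) x y)
      (fun x' _ => Finset.sum_nonneg fun y' _ => hnn x' y') (Finset.mem_univ x)))

end Chains

/-! ### Relative entropy and the Gibbs variational principle. -/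

section Gibbs

theorem coe_sum {α : Type*} (s : Finset α) (f : α → ℝ) :
    ((∑ a ∈ s, f a : ℝ) : EReal) = ∑ a ∈ s, (f a : EReal) := by
  classical
  induction s using Finset.induction_on with
  | empty => simp
  | insert a s ha ih => rw [Finset.sum_insert ha, Finset.sum_insert ha, EReal.coe_add, ih]

variable {α : Type*} [Fintype α]

theorem sum_mul_exp_pos {ν : α → ℝ} (hν : ν ∈ stdSimplex ℝ α) (g : α → ℝ) :
    0 < ∑ a, ν a * Real.exp (g a) := by
  obtain ⟨a, -, ha⟩ : ∃ a ∈ Finset.univ, 0 < ν a := by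
    by_contra! h
    have := Finset.sum_nonpos h
    rw [hν.2] at this
    linarith
  exact Finset.sum_pos' (fun b _ => mul_nonneg (hν.1 b) (Real.exp_pos _).le)
    ⟨a, Finset.mem_univ _, mul_pos ha (Real.exp_pos _)⟩

theorem sum_mul_exp_sub_log {ν : α → ℝ} (hν : ν ∈ stdSimplex ℝ α) (g : α → ℝ) :
    ∑ a, ν a * Real.exp (g a - Real.log (∑ b, ν b * Real.exp (g b))) = 1 := by
  have hpos := sum_mul_exp_pos hν g
  simp_rw [Real.exp_sub, Real.exp_log hpos, ← mul_div_assoc]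
  rw [← Finset.sum_div, div_self hpos.ne']

/-- Jensen's inequality for the logarithmic moment generating function. -/
theorem sum_mul_le_log_sum_exp {p : α → ℝ} (hp : p ∈ stdSimplex ℝ α) (d : α → ℝ) :
    ∑ a, p a * d a ≤ Real.log (∑ a, p a * Real.exp (d a)) := by
  rw [Real.le_log_iff_exp_le (sum_mul_exp_pos hp d)]
  set m := ∑ a, p a * d a with hm
  -- The exponential lies above its tangent line at the mean `m`.
  have h : ∑ a, p a * (Real.exp m * (d a - m + 1)) ≤ ∑ a, p a * Real.exp (d a) := by
    refine Finset.sum_le_sum fun a _ => mul_le_mul_of_nonneg_left ?_ (hp.1 a)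
    calc Real.exp m * (d a - m + 1) ≤ Real.exp m * Real.exp (d a - m) :=
          mul_le_mul_of_nonneg_left (Real.add_one_le_exp _) (Real.exp_pos _).le
      _ = Real.exp (d a) := by rw [← Real.exp_add]; ring_nf
  have h2 : ∑ a, p a * (Real.exp m * (d a - m + 1)) = Real.exp m := by
    have : ∀ a, p a * (Real.exp m * (d a - m + 1)) =
        Real.exp m * (p a * d a) + Real.exp m * (1 - m) * p a := fun a => by ring
    simp_rw [this, Finset.sum_add_distrib, ← Finset.mul_sum]
    rw [hp.2, ← hm]
    ring
  rwa [h2] at h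

/-- The Gibbs variational principle, with its equality case. -/
theorem relEntropy_gibbs {μ ν : α → ℝ} (hμ : μ ∈ stdSimplex ℝ α) (hν : ν ∈ stdSimplex ℝ α)
    (g : α → ℝ) :
    (relEntropy μ ν = ⊤ ∧
      μ ≠ fun a => ν a * Real.exp (g a - Real.log (∑ b, ν b * Real.exp (g b)))) ∨
    ∃ r : ℝ, relEntropy μ ν = r ∧
      ∑ a, μ a * g a - Real.log (∑ b, ν b * Real.exp (g b)) ≤ r ∧
      (∑ a, μ a * g a - Real.log (∑ b, ν b * Real.exp (g b)) = r ↔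
        μ = fun a => ν a * Real.exp (g a - Real.log (∑ b, ν b * Real.exp (g b)))) := by
  set Λ := Real.log (∑ b, ν b * Real.exp (g b)) with hΛ
  by_cases hac : ∀ a, ν a = 0 → μ a = 0
  · right
    refine ⟨∑ a, μ a * Real.log (μ a / ν a), by simp only [relEntropy, if_pos hac], ?_⟩
    set τ : α → ℝ := fun a => ν a * Real.exp (g a - Λ) with hτ
    have hτ0 : ∀ a, 0 ≤ τ a := fun a => mul_nonneg (hν.1 a) (Real.exp_pos _).le
    have hτ1 : ∑ a, τ a = 1 := sum_mul_exp_sub_log hν g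
    -- Entropy relative to `ν` is re-expressed through the tilted pmf `τ`. The correction `μ - τ`
    -- sums to zero and makes the remainder, a `klFun` term, nonnegative pointwise.
    have hterm : ∀ a, μ a * Real.log (μ a / ν a) =
        μ a * g a - Λ * μ a + (μ a - τ a) + τ a * InformationTheory.klFun (μ a / τ a) := by
      intro a
      rcases (hν.1 a).eq_or_lt with h0 | hpos
      · simp [hτ, hac a h0.symm, ← h0]
      rcases (hμ.1 a).eq_or_lt with h0 | hμpos
      · simp [← h0, InformationTheory.klFun_zero]
      have hτa : 0 < τ a := mul_pos hpos (Real.exp_pos _)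
      have hlog : Real.log (μ a / τ a) = Real.log (μ a / ν a) - (g a - Λ) := by
        rw [hτ, Real.log_div hμpos.ne' hτa.ne', Real.log_mul hpos.ne' (Real.exp_pos _).ne',
          Real.log_exp, Real.log_div hμpos.ne' hpos.ne']
        ring
      rw [InformationTheory.klFun_apply, hlog]
      field_simp
      ring
    have hsum : ∑ a, μ a * Real.log (μ a / ν a) =
        ∑ a, μ a * g a - Λ + ∑ a, τ a * InformationTheory.klFun (μ a / τ a) := by
      rw [Finset.sum_congr rfl fun a _ => hterm a]
      simp only [Finset.sum_add_distrib, Finset.sum_sub_distrib, ← Finset.mul_sum]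
      rw [hμ.2, hτ1]
      ring
    have hnn : ∀ a ∈ Finset.univ, 0 ≤ τ a * InformationTheory.klFun (μ a / τ a) := fun a _ =>
      mul_nonneg (hτ0 a) (InformationTheory.klFun_nonneg (div_nonneg (hμ.1 a) (hτ0 a)))
    rw [hsum]
    refine ⟨by linarith [Finset.sum_nonneg hnn], ?_⟩
    rw [left_eq_add, Finset.sum_eq_zero_iff_of_nonneg hnn]
    constructor
    · intro h
      funext a
      rcases (hν.1 a).eq_or_lt with h0 | hpos
      · simp [hac a h0.symm, ← h0, hτ]
      have hτa : 0 < τ a := mul_pos hpos (Real.exp_pos _)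
      have h1 := (mul_eq_zero.1 (h a (Finset.mem_univ a))).resolve_left hτa.ne'
      rw [InformationTheory.klFun_eq_zero_iff (div_nonneg (hμ.1 a) hτa.le),
        div_eq_one_iff_eq hτa.ne'] at h1
      exact h1
    · intro h a _
      rcases (hτ0 a).eq_or_lt with h0 | hpos
      · simp [← h0]
      · simp [h, div_self hpos.ne', InformationTheory.klFun_one]
  · left
    refine ⟨by simp only [relEntropy, if_neg hac], fun h => hac fun a ha => ?_⟩
    simp [h, ha]

end Gibbs

/-! ### Controlled transition matrices and exponential tilting. -/

variable {Xu Xn : Type*} [Fintype Xu] [Fintype Xn]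

theorem sum_transition_mul (R : Matrix (Xu × Xn) Xu ℝ) (Q : Matrix (Xu × Xn) Xn ℝ)
    (x : Xu × Xn) (f : Xu × Xn → ℝ) :
    ∑ x', transition R Q x x' * f x' = ∑ u, R x u * ∑ n, Q x n * f (u, n) := by
  rw [Fintype.sum_prod_type]
  simp [transition, Finset.mul_sum, mul_assoc]

theorem isKernel_transition {R : Matrix (Xu × Xn) Xu ℝ} {Q : Matrix (Xu × Xn) Xn ℝ}
    (hR : IsKernel R) (hQ : IsKernel Q) : IsKernel (transition R Q) := by
  refine fun x => ⟨fun x' => mul_nonneg (hR.nonneg _ _) (hQ.nonneg _ _), ?_⟩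
  have := sum_transition_mul R Q x fun _ => 1
  simpa [hQ.sum_eq_one, hR.sum_eq_one] using this

variable [DecidableEq Xu] [DecidableEq Xn]

namespace Model

variable (M : Model Xu Xn)

theorem isKernel_P {R : Matrix (Xu × Xn) Xu ℝ} (hR : IsKernel R) : IsKernel (M.P R) :=
  isKernel_transition hR M.kernel_Q₀

theorem isKernel_P₀ : IsKernel M.P₀ := M.isKernel_P M.kernel_R₀

/-- Given `x`, `x'_n` is independent of `x'_u` with law `Q₀`, whatever the rule. This is what lets
Gibbs' principle be applied with a tilt depending on `x'_u` alone, which leaves nature's factor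
intact. -/
theorem sum_P_mul_condMean (R : Matrix (Xu × Xn) Xu ℝ) (h : Xu × Xn → ℝ) (x : Xu × Xn) :
    ∑ x', M.P R x x' * M.condMean h x x' = ∑ x', M.P R x x' * h x' := by
  unfold P
  rw [sum_transition_mul, sum_transition_mul]
  refine Finset.sum_congr rfl fun u _ => ?_
  simp only [condMean]
  rw [← Finset.sum_mul, M.kernel_Q₀.sum_eq_one, one_mul]

/-- The decision rule that induces `P_h`. -/
noncomputable def tiltRule (h : Xu × Xn → ℝ) : Matrix (Xu × Xn) Xu ℝ :=
  Matrix.of fun x u => M.R₀ x u *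
    Real.exp (∑ n, M.Q₀ x n * h (u, n) - M.logMGF (M.condMean h) x)

theorem P_tiltRule (h : Xu × Xn → ℝ) : M.P (M.tiltRule h) = M.Ph h := by
  ext x x'
  simp only [P, transition, tiltRule, Ph, tilt, P₀, Matrix.of_apply, condMean]
  ring

theorem isKernel_Ph (h : Xu × Xn → ℝ) : IsKernel (M.Ph h) := fun x =>
  ⟨fun x' => mul_nonneg (M.isKernel_P₀.nonneg x x') (Real.exp_pos _).le,
    sum_mul_exp_sub_log (M.isKernel_P₀ x) (M.condMean h x)⟩

theorem isKernel_tiltRule (h : Xu × Xn → ℝ) : IsKernel (M.tiltRule h) := by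
  refine fun x => ⟨fun u => mul_nonneg (M.kernel_R₀.nonneg x u) (Real.exp_pos _).le, ?_⟩
  have h1 := sum_transition_mul (M.tiltRule h) M.Q₀ x fun _ => 1
  have h2 := (M.isKernel_Ph h).sum_eq_one x
  rw [← P_tiltRule, P] at h2
  simpa [h2, M.kernel_Q₀.sum_eq_one] using h1.symm

theorem sum_Ph_mul_condMean (h g : Xu × Xn → ℝ) (x : Xu × Xn) :
    ∑ x', M.Ph h x x' * M.condMean g x x' = ∑ x', M.Ph h x x' * g x' := by
  rw [← P_tiltRule, sum_P_mul_condMean]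

theorem Ph_pos (h : Xu × Xn → ℝ) (x x' : Xu × Xn) (hx : 0 < M.P₀ x x') : 0 < M.Ph h x x' :=
  mul_pos hx (Real.exp_pos _)

theorem isIrreducible_Ph (h : Xu × Xn → ℝ) : (M.Ph h).IsIrreducible :=
  isIrreducible_of_support M.irreducible (M.isKernel_Ph h).nonneg (M.Ph_pos h)

theorem isAperiodic_Ph (h : Xu × Xn → ℝ) : IsAperiodic (M.Ph h) :=
  isAperiodic_of_support M.aperiodic M.isKernel_P₀.nonneg (M.isKernel_Ph h).nonneg (M.Ph_pos h)

/-! ### Properties of the logarithmic moment generating function -/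

theorem condMean_add_const (h : Xu × Xn → ℝ) (c : ℝ) (x x' : Xu × Xn) :
    M.condMean (fun y => h y + c) x x' = M.condMean h x x' + c := by
  simp only [condMean, mul_add, Finset.sum_add_distrib]
  rw [← Finset.sum_mul, M.kernel_Q₀.sum_eq_one, one_mul]

theorem logMGF_le (h : Xu × Xn → ℝ) (c : ℝ) (hc : ∀ x, h x ≤ c) (x : Xu × Xn) :
    M.logMGF (M.condMean h) x ≤ c := by
  rw [logMGF, Real.log_le_iff_le_exp (sum_mul_exp_pos (M.isKernel_P₀ x) _)]
  calc ∑ x', M.P₀ x x' * Real.exp (M.condMean h x x')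
      ≤ ∑ x', M.P₀ x x' * Real.exp c := by
        refine Finset.sum_le_sum fun x' _ =>
          mul_le_mul_of_nonneg_left (Real.exp_le_exp.2 ?_) (M.isKernel_P₀.nonneg x x')
        calc M.condMean h x x' ≤ ∑ n, M.Q₀ x n * c :=
              Finset.sum_le_sum fun n _ =>
                mul_le_mul_of_nonneg_left (hc _) (M.kernel_Q₀.nonneg x n)
          _ = c := by rw [← Finset.sum_mul, M.kernel_Q₀.sum_eq_one, one_mul]
    _ = Real.exp c := M.isKernel_P₀.sum_mul_const x _

theorem sum_P₀_mul_le_logMGF (h : Xu × Xn → ℝ) (x : Xu × Xn) :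
    ∑ x', M.P₀ x x' * h x' ≤ M.logMGF (M.condMean h) x := by
  rw [P₀, ← sum_P_mul_condMean]
  exact sum_mul_le_log_sum_exp (M.isKernel_P₀ x) _

/-- Convexity of `h ↦ Λ_h`: the gradient at `h` is `P_h`. -/
theorem sum_Ph_mul_sub_le (h g : Xu × Xn → ℝ) (x : Xu × Xn) :
    ∑ x', M.Ph h x x' * (g x' - h x') ≤
      M.logMGF (M.condMean g) x - M.logMGF (M.condMean h) x := by
  have h1 := sum_mul_le_log_sum_exp (M.isKernel_Ph h x)
    (fun x' => M.condMean g x x' - M.condMean h x x')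
  -- Change of measure: the `P_h`-mean of `exp (g - h)` is `exp (Λ_g - Λ_h)`, with conditional means
  -- in the exponent.
  have h2 : ∑ x', M.Ph h x x' * Real.exp (M.condMean g x x' - M.condMean h x x') =
      (∑ x', M.P₀ x x' * Real.exp (M.condMean g x x')) *
        Real.exp (-M.logMGF (M.condMean h) x) := by
    rw [Finset.sum_mul]
    refine Finset.sum_congr rfl fun x' _ => ?_
    simp only [Ph, tilt, Matrix.of_apply]
    rw [mul_assoc, mul_assoc, ← Real.exp_add, ← Real.exp_add]
    ring_nf
  rw [h2, Real.log_mul (sum_mul_exp_pos (M.isKernel_P₀ x) _).ne' (Real.exp_pos _).ne',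
    Real.log_exp] at h1
  simp_rw [mul_sub, Finset.sum_sub_distrib, sum_Ph_mul_condMean] at h1
  simp_rw [mul_sub, Finset.sum_sub_distrib]
  exact h1

/-! ### The optimality equation in real form -/

/-- The optimality equation `f + Λ_h = h + η`, obtained by carrying out the maximization. -/
def SolvesLogEq (f h : Xu × Xn → ℝ) (η : ℝ) : Prop :=
  ∀ x, f x + M.logMGF (M.condMean h) x = h x + η

variable {M}

/-- Convexity gives `P_{h'} (h - h') ≤ (h - h') + (η - η')`. Integrating against the invariant pmf
of `P_{h'}` yields `η' ≤ η`, and equality by symmetry. Then `h - h'` is subharmonic for `P_h`, hence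
constant. -/
theorem SolvesLogEq.unique {f h h' : Xu × Xn → ℝ} {η η' : ℝ} (H : M.SolvesLogEq f h η)
    (H' : M.SolvesLogEq f h' η') {x₀ : Xu × Xn} (h0 : h x₀ = h' x₀) : h = h' ∧ η = η' := by
  have : Nonempty (Xu × Xn) := ⟨x₀⟩
  have hle : ∀ {h h' : Xu × Xn → ℝ} {η η' : ℝ}, M.SolvesLogEq f h η → M.SolvesLogEq f h' η' →
      η' ≤ η := by
    intro h h' η η' H H'
    obtain ⟨π, hπ, -⟩ := existsUnique_invariantPmf (M.isKernel_Ph h') (M.isIrreducible_Ph h')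
    have h1 : ∀ x, ∑ x', M.Ph h' x x' * (h x' - h' x') ≤ (h x - h' x) + (η - η') := fun x => by
      linarith [M.sum_Ph_mul_sub_le h' h x, H x, H' x]
    have h2 := Finset.sum_le_sum fun x (_ : x ∈ Finset.univ) =>
      mul_le_mul_of_nonneg_left (h1 x) (hπ.1.1 x)
    rw [sum_mulVec_of_invariant hπ.2 fun x' => h x' - h' x'] at h2
    simp_rw [mul_add _ (h _ - h' _), Finset.sum_add_distrib, ← Finset.sum_mul] at h2
    rw [hπ.1.2] at h2
    linarith
  have hη : η = η' := le_antisymm (hle H' H) (hle H H')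
  refine ⟨funext fun x => ?_, hη⟩
  have h2 := eq_of_subharmonic (M.isKernel_Ph h) (M.isIrreducible_Ph h)
    (d := fun x => h x - h' x) (fun x => by
      have h3 : ∑ x', M.Ph h x x' * (h' x' - h x') = -∑ x', M.Ph h x x' * (h x' - h' x') := by
        rw [← Finset.sum_neg_distrib]
        exact Finset.sum_congr rfl fun _ _ => by ring
      linarith [M.sum_Ph_mul_sub_le h h' x, H x, H' x]) x x₀
  simp only [h0, sub_self] at h2
  linarith

variable (M)

/-- Solutions of the Poisson equation for `P_h`, normalized at `x₀`, are given by `𝒱(h)`. -/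
theorem vectorField_spec (h : Xu × Xn → ℝ) :
    M.vectorField h M.x₀ = 0 ∧ ∃ c : ℝ, ∀ x,
      M.vectorField h x - ∑ x', M.Ph h x x' * M.vectorField h x' = M.U x - c := by
  have : Nonempty (Xu × Xn) := ⟨M.x₀⟩
  set y : Xu × Xn → ℝ := fundamentalMatrix (M.Ph h) *ᵥ M.U with hy
  have hV : ∀ x, M.vectorField h x = y x - y M.x₀ := fun x => by
    simp [vectorField, poissonSol, hy, Matrix.mulVec, dotProduct, sub_mul]
  have hunit := isUnit_preFundamental (M.isKernel_Ph h) (M.isIrreducible_Ph h)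
  have h1 : preFundamental (M.Ph h) *ᵥ y = M.U := by
    rw [hy, Matrix.mulVec_mulVec, fundamentalMatrix,
      Matrix.mul_nonsing_inv _ ((Matrix.isUnit_iff_isUnit_det _).1 hunit), Matrix.one_mulVec]
  refine ⟨by rw [hV, sub_self], ∑ x', invariantPmf (M.Ph h) x' * y x', fun x => ?_⟩
  simp_rw [hV, mul_sub, Finset.sum_sub_distrib]
  rw [(M.isKernel_Ph h).sum_mul_const]
  have h2 := congrFun h1 x
  rw [preFundamental, Matrix.add_mulVec, Matrix.sub_mulVec, Matrix.one_mulVec] at h2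
  simp only [Pi.add_apply, Pi.sub_apply, Matrix.mulVec, dotProduct, Matrix.of_apply] at h2
  linarith

/-- Two solutions of Poisson's equation differ by a `d` with `d - P_h d` constant, so by a constant,
which the normalization kills. -/
theorem eq_vectorField (h : Xu × Xn → ℝ) {g : Xu × Xn → ℝ} {c : ℝ} (h0 : g M.x₀ = 0)
    (hg : ∀ x, g x - ∑ x', M.Ph h x x' * g x' = M.U x - c) : g = M.vectorField h := by
  have : Nonempty (Xu × Xn) := ⟨M.x₀⟩
  obtain ⟨hV0, c', hV⟩ := M.vectorField_spec h
  obtain ⟨-, h1⟩ := eq_of_sub_mulVec_const (M.isKernel_Ph h) (M.isIrreducible_Ph h)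
    (d := fun x => g x - M.vectorField h x) (c := c' - c) (fun x => by
      simp_rw [mul_sub, Finset.sum_sub_distrib]
      linarith [hg x, hV x])
  funext x
  have h2 := h1 x M.x₀
  simp only [h0, hV0, sub_self] at h2
  linarith

/-! ### Solving the optimality equation by the inverse function theorem -/

/-- `condMean` as a continuous linear functional of `h`. -/
noncomputable def condMeanCLM (x x' : Xu × Xn) : (Xu × Xn → ℝ) →L[ℝ] ℝ :=
  ∑ n, M.Q₀ x n • ContinuousLinearMap.proj (R := ℝ) (φ := fun _ : Xu × Xn => ℝ) (x'.1, n)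

theorem condMeanCLM_apply (x x' : Xu × Xn) (h : Xu × Xn → ℝ) :
    M.condMeanCLM x x' h = M.condMean h x x' := by
  simp [condMeanCLM, condMean]

theorem hasStrictFDerivAt_logMGF (h : Xu × Xn → ℝ) (x : Xu × Xn) :
    HasStrictFDerivAt (fun h => M.logMGF (M.condMean h) x)
      (∑ x', M.Ph h x x' • M.condMeanCLM x x') h := by
  have hpos := sum_mul_exp_pos (M.isKernel_P₀ x) (M.condMean h x)
  have h1 : ∀ x', HasStrictFDerivAt (fun h => M.P₀ x x' * Real.exp (M.condMean h x x'))
      (M.P₀ x x' • (Real.exp (M.condMean h x x') • M.condMeanCLM x x')) h := fun x' => by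
    have h2 := (M.condMeanCLM x x').hasStrictFDerivAt.congr_of_eventuallyEq (x := h)
      (.of_forall fun h => M.condMeanCLM_apply x x' h)
    exact h2.exp.const_mul _
  have h3 := (HasStrictFDerivAt.fun_sum fun x' (_ : x' ∈ Finset.univ) => h1 x').log hpos.ne'
  refine h3.congr_fderiv ?_
  rw [Finset.smul_sum]
  refine Finset.sum_congr rfl fun x' _ => ?_
  rw [smul_smul, smul_smul]
  congr 1
  simp only [Ph, tilt, Matrix.of_apply, logMGF]
  rw [Real.exp_sub, Real.exp_log hpos]
  field_simp

/-- The map whose value at `h` is the function `f` for which `h - h(x₀)` solves the optimality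
equation with optimal reward `h(x₀)`. -/
noncomputable def logEqMap (h : Xu × Xn → ℝ) : Xu × Xn → ℝ :=
  fun x => h x - M.logMGF (M.condMean h) x + h M.x₀

/-- The derivative of `logEqMap`. -/
noncomputable def logEqDeriv (h : Xu × Xn → ℝ) : (Xu × Xn → ℝ) →L[ℝ] (Xu × Xn → ℝ) :=
  ContinuousLinearMap.pi fun x =>
    ContinuousLinearMap.proj (R := ℝ) (φ := fun _ : Xu × Xn => ℝ) x -
      ∑ x', M.Ph h x x' • M.condMeanCLM x x' +
      ContinuousLinearMap.proj (R := ℝ) (φ := fun _ : Xu × Xn => ℝ) M.x₀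

theorem logEqDeriv_apply (h g : Xu × Xn → ℝ) (x : Xu × Xn) :
    M.logEqDeriv h g x = g x - ∑ x', M.Ph h x x' * g x' + g M.x₀ := by
  simp [logEqDeriv, condMeanCLM_apply, sum_Ph_mul_condMean]

theorem hasStrictFDerivAt_logEqMap (h : Xu × Xn → ℝ) :
    HasStrictFDerivAt M.logEqMap (M.logEqDeriv h) h := by
  have hp : ∀ x : Xu × Xn, HasStrictFDerivAt (fun h : Xu × Xn → ℝ => h x)
      (ContinuousLinearMap.proj (R := ℝ) (φ := fun _ : Xu × Xn => ℝ) x) h := fun x =>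
    (ContinuousLinearMap.proj (R := ℝ) (φ := fun _ : Xu × Xn => ℝ) x).hasStrictFDerivAt
  exact hasStrictFDerivAt_pi.2 fun x =>
    ((hp x).sub (M.hasStrictFDerivAt_logMGF h x)).add (hp M.x₀)

/-- A null vector has `g - P_h g` equal to the constant `-g(x₀)`; this constant vanishes and `g` is
constant. -/
theorem logEqDeriv_injective (h : Xu × Xn → ℝ) : Function.Injective (M.logEqDeriv h) := by
  have : Nonempty (Xu × Xn) := ⟨M.x₀⟩
  rw [injective_iff_map_eq_zero]
  intro g hg
  obtain ⟨h1, h2⟩ := eq_of_sub_mulVec_const (M.isKernel_Ph h) (M.isIrreducible_Ph h)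
    (d := g) (c := -g M.x₀) fun x => by
      have := congrFun hg x
      rw [logEqDeriv_apply, Pi.zero_apply] at this
      linarith
  funext x
  rw [h2 x M.x₀, Pi.zero_apply]
  linarith

/-- The derivative of `logEqMap` as a continuous linear equivalence. -/
noncomputable def logEqDerivEquiv (h : Xu × Xn → ℝ) : (Xu × Xn → ℝ) ≃L[ℝ] (Xu × Xn → ℝ) :=
  (LinearEquiv.ofInjectiveEndo (M.logEqDeriv h : (Xu × Xn → ℝ) →ₗ[ℝ] (Xu × Xn → ℝ))
    (M.logEqDeriv_injective h)).toContinuousLinearEquiv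

theorem logEqDerivEquiv_apply (h g : Xu × Xn → ℝ) :
    M.logEqDerivEquiv h g = M.logEqDeriv h g := rfl

theorem hasStrictFDerivAt_logEqMap_equiv (h : Xu × Xn → ℝ) :
    HasStrictFDerivAt M.logEqMap
      (M.logEqDerivEquiv h : (Xu × Xn → ℝ) →L[ℝ] (Xu × Xn → ℝ)) h :=
  M.hasStrictFDerivAt_logEqMap h

theorem logMGF_add_const (h : Xu × Xn → ℝ) (c : ℝ) (x : Xu × Xn) :
    M.logMGF (M.condMean fun y => h y + c) x = M.logMGF (M.condMean h) x + c := by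
  have hpos := sum_mul_exp_pos (M.isKernel_P₀ x) (M.condMean h x)
  simp only [logMGF, condMean_add_const, Real.exp_add, ← mul_assoc]
  rw [← Finset.sum_mul, Real.log_mul hpos.ne' (Real.exp_pos c).ne', Real.log_exp]

theorem solvesLogEq_logEqMap (h : Xu × Xn → ℝ) :
    M.SolvesLogEq (M.logEqMap h) (fun x => h x - h M.x₀) (h M.x₀) := fun x => by
  simp only [sub_eq_add_neg, logMGF_add_const, logEqMap]
  ring

theorem logEqMap_injective : Function.Injective M.logEqMap := by
  intro h h' hh
  have H := M.solvesLogEq_logEqMap h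
  rw [hh] at H
  obtain ⟨h1, h2⟩ := H.unique (M.solvesLogEq_logEqMap h') (x₀ := M.x₀) (by simp)
  funext x
  have := congrFun h1 x
  linarith

/-- A priori bound: `logEqMap` is proper. -/
theorem exists_norm_le_of_norm_logEqMap_le {c : ℝ} (hc : 0 ≤ c) :
    ∃ B : ℝ, ∀ h, ‖M.logEqMap h‖ ≤ c → ‖h‖ ≤ B := by
  have : Nonempty (Xu × Xn) := ⟨M.x₀⟩
  obtain ⟨B, hB⟩ := exists_bound_of_mulVec_le M.isKernel_P₀ M.irreducible
    (c := 2 * c) (by positivity)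
  refine ⟨c + B, fun h hh => ?_⟩
  have hf : ∀ x, |h x - M.logMGF (M.condMean h) x + h M.x₀| ≤ c := fun x =>
    (norm_le_pi_norm (M.logEqMap h) x).trans hh
  obtain ⟨a, ha⟩ := Finite.exists_min h
  obtain ⟨b, hb⟩ := Finite.exists_max h
  -- At a maximizer of `h`, `Λ_h ≤ h`; at a minimizer, `h ≤ Λ_h`. These two points bound `h(x₀)`
  -- from both sides.
  have h1 : h M.x₀ ≤ c := by
    have h2 := M.sum_P₀_mul_le_logMGF h
    have h3 := M.logMGF_le h (h b) hb b
    linarith [(abs_le.1 (hf b)).2]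
  have h2 : -c ≤ h M.x₀ := by
    have h3 : h a ≤ M.logMGF (M.condMean h) a := by
      refine le_trans ?_ (M.sum_P₀_mul_le_logMGF h a)
      rw [← M.isKernel_P₀.sum_mul_const a (h a)]
      exact Finset.sum_le_sum fun y _ =>
        mul_le_mul_of_nonneg_left (ha y) (M.isKernel_P₀.nonneg a y)
    linarith [(abs_le.1 (hf a)).1]
  -- Jensen gives `P₀ h ≤ Λ_h ≤ h + h(x₀) + c ≤ h + 2c`, which bounds the oscillation of `h`.
  have hk := hB (fun x => h x - h a) (fun x => sub_nonneg.2 (ha x)) (fun x => by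
    simp_rw [mul_sub, Finset.sum_sub_distrib]
    rw [M.isKernel_P₀.sum_mul_const]
    linarith [M.sum_P₀_mul_le_logMGF h x, (abs_le.1 (hf x)).1]) a (sub_self _)
  have hB0 : 0 ≤ B := by simpa using hk a
  refine (pi_norm_le_iff_of_nonneg (by positivity)).2 fun x => ?_
  rw [Real.norm_eq_abs, abs_le]
  have h3 := hk x
  have h4 := hk M.x₀
  have h5 := ha x
  have h6 := ha M.x₀
  constructor <;> linarith

theorem continuous_logEqMap : Continuous M.logEqMap :=
  continuous_iff_continuousAt.2 fun h => (M.hasStrictFDerivAt_logEqMap h).continuousAt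

theorem isProperMap_logEqMap : IsProperMap M.logEqMap := by
  rw [isProperMap_iff_isCompact_preimage]
  refine ⟨M.continuous_logEqMap, fun K hK => ?_⟩
  obtain ⟨c, hc0, hc⟩ := hK.isBounded.exists_pos_norm_le
  obtain ⟨B, hB⟩ := M.exists_norm_le_of_norm_logEqMap_le hc0.le
  refine Metric.isCompact_of_isClosed_isBounded (hK.isClosed.preimage M.continuous_logEqMap) ?_
  exact isBounded_iff_forall_norm_le.2 ⟨B, fun h hh => hB h (hc _ hh)⟩

/-- The range is closed by properness, open by the inverse function theorem, and nonempty in a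
connected space. -/
theorem logEqMap_surjective : Function.Surjective M.logEqMap := by
  rw [← Set.range_eq_univ]
  exact IsClopen.eq_univ ⟨M.isProperMap_logEqMap.isClosedMap.isClosed_range,
    (isOpenMap_of_hasStrictFDerivAt_equiv M.hasStrictFDerivAt_logEqMap_equiv).isOpen_range⟩
    (Set.range_nonempty _)

/-- The inverse of `logEqMap`. -/
noncomputable def logEqInv (f : Xu × Xn → ℝ) : Xu × Xn → ℝ :=
  (Equiv.ofBijective M.logEqMap ⟨M.logEqMap_injective, M.logEqMap_surjective⟩).symm f

theorem logEqMap_logEqInv (f : Xu × Xn → ℝ) : M.logEqMap (M.logEqInv f) = f :=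
  (Equiv.ofBijective M.logEqMap ⟨M.logEqMap_injective, M.logEqMap_surjective⟩).apply_symm_apply f

theorem logEqInv_logEqMap (h : Xu × Xn → ℝ) : M.logEqInv (M.logEqMap h) = h :=
  M.logEqMap_injective (M.logEqMap_logEqInv _)

theorem hasFDerivAt_logEqInv (f : Xu × Xn → ℝ) :
    HasFDerivAt M.logEqInv
      ((M.logEqDerivEquiv (M.logEqInv f)).symm : (Xu × Xn → ℝ) →L[ℝ] (Xu × Xn → ℝ)) f := by
  have := ((M.hasStrictFDerivAt_logEqMap_equiv (M.logEqInv f)).to_local_left_inverse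
    (.of_forall M.logEqInv_logEqMap)).hasFDerivAt
  rwa [M.logEqMap_logEqInv] at this

/-! ### The relative value function and the differential equation -/

/-- The optimal average reward. -/
noncomputable def optReward (ζ : ℝ) : ℝ := M.logEqInv (ζ • M.U) M.x₀

/-- The relative value function. -/
noncomputable def relValue (ζ : ℝ) : Xu × Xn → ℝ :=
  fun x => M.logEqInv (ζ • M.U) x - M.logEqInv (ζ • M.U) M.x₀

theorem relValue_x₀ (ζ : ℝ) : M.relValue ζ M.x₀ = 0 := sub_self _

theorem solvesLogEq_relValue (ζ : ℝ) :
    M.SolvesLogEq (ζ • M.U) (M.relValue ζ) (M.optReward ζ) := by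
  have := M.solvesLogEq_logEqMap (M.logEqInv (ζ • M.U))
  rwa [M.logEqMap_logEqInv] at this

theorem Ph_add_const (h : Xu × Xn → ℝ) (c : ℝ) : M.Ph (fun x => h x + c) = M.Ph h := by
  ext x x'
  simp only [Ph, tilt, Matrix.of_apply, logMGF_add_const, condMean_add_const,
    add_sub_add_right_eq_sub]

theorem logMGF_zero (x : Xu × Xn) : M.logMGF (M.condMean 0) x = 0 := by
  have h1 : M.condMean 0 x = 0 := by
    funext x'
    simp [condMean]
  simp [logMGF, h1, M.isKernel_P₀.sum_eq_one]

theorem solvesODE_relValue : M.SolvesODE M.relValue := by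
  constructor
  · have hz : M.SolvesLogEq ((0 : ℝ) • M.U) 0 0 := fun x => by
      simp [logMGF_zero]
    exact ((M.solvesLogEq_relValue 0).unique hz (x₀ := M.x₀) (M.relValue_x₀ 0)).1
  · intro ζ
    set θ := M.logEqInv (ζ • M.U) with hθ
    set g := (M.logEqDerivEquiv θ).symm M.U with hg
    have hd : HasDerivAt (fun ζ : ℝ => M.logEqInv (ζ • M.U)) g ζ := by
      have h1 : HasDerivAt (fun ζ : ℝ => ζ • M.U) M.U ζ := by
        simpa using (hasDerivAt_id ζ).smul_const M.U
      exact (M.hasFDerivAt_logEqInv (ζ • M.U)).comp_hasDerivAt ζ h1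
    rw [hasDerivAt_pi] at hd
    -- This is Poisson's equation for `P_θ` with constant `g(x₀)`; subtracting `g(x₀)` from `g`
    -- normalizes it, and `P_θ` ignores additive constants in `θ`.
    have hgU : ∀ x, g x - ∑ x', M.Ph θ x x' * g x' + g M.x₀ = M.U x := fun x => by
      rw [← logEqDeriv_apply, ← logEqDerivEquiv_apply, hg,
        ContinuousLinearEquiv.apply_symm_apply]
    have hPh : M.Ph (M.relValue ζ) = M.Ph θ := M.Ph_add_const θ (-θ M.x₀)
    have hV := M.eq_vectorField (M.relValue ζ) (g := fun x => g x - g M.x₀) (c := g M.x₀)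
      (sub_self _) (fun x => by
        simp_rw [hPh, mul_sub, Finset.sum_sub_distrib]
        rw [(M.isKernel_Ph θ).sum_mul_const]
        linarith [hgU x])
    rw [← hV, hasDerivAt_pi]
    exact fun x => (hd x).sub (hd M.x₀)

theorem eq_relValue_of_solvesODE {h : ℝ → Xu × Xn → ℝ} (hh : M.SolvesODE h) :
    h = M.relValue := by
  obtain ⟨h0, hd⟩ := hh
  have hx₀ : ∀ ζ, h ζ M.x₀ = 0 := fun ζ => by
    have h1 : ∀ ζ, HasDerivAt (fun ζ => h ζ M.x₀) 0 ζ := fun ζ => by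
      have := hasDerivAt_pi.1 (hd ζ) M.x₀
      rwa [(M.vectorField_spec (h ζ)).1] at this
    have h2 := is_const_of_deriv_eq_zero (fun ζ => (h1 ζ).differentiableAt)
      (fun ζ => (h1 ζ).deriv) ζ 0
    rw [h2, h0, Pi.zero_apply]
  have hG : ∀ ζ x, HasDerivAt (fun ζ => h ζ x - M.logMGF (M.condMean (h ζ)) x)
      (M.vectorField (h ζ) x - ∑ x', M.Ph (h ζ) x x' * M.vectorField (h ζ) x') ζ := by
    intro ζ x
    have h1 := (M.hasStrictFDerivAt_logMGF (h ζ) x).hasFDerivAt.comp_hasDerivAt ζ (hd ζ)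
    have h2 := (hasDerivAt_pi.1 (hd ζ) x).sub h1
    simp only [sum_apply, smul_apply, smul_eq_mul,
      condMeanCLM_apply, sum_Ph_mul_condMean] at h2
    exact h2
  -- By Poisson's equation `h - Λ_h - ζ U` has the same `ζ`-derivative at every state, and it
  -- vanishes at `ζ = 0`.
  have hconst : ∀ ζ x, (h ζ x - M.logMGF (M.condMean (h ζ)) x) - ζ * M.U x =
      (h ζ M.x₀ - M.logMGF (M.condMean (h ζ)) M.x₀) - ζ * M.U M.x₀ := by
    intro ζ x
    have h1 : ∀ ζ, HasDerivAt (fun ζ => ((h ζ x - M.logMGF (M.condMean (h ζ)) x) - ζ * M.U x) -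
        ((h ζ M.x₀ - M.logMGF (M.condMean (h ζ)) M.x₀) - ζ * M.U M.x₀)) 0 ζ := fun ζ => by
      obtain ⟨-, c, hc⟩ := M.vectorField_spec (h ζ)
      have h2 := ((hG ζ x).sub ((hasDerivAt_id ζ).mul_const (M.U x))).sub
        ((hG ζ M.x₀).sub ((hasDerivAt_id ζ).mul_const (M.U M.x₀)))
      rw [hc, hc] at h2
      refine h2.congr_deriv ?_
      ring
    have h2 := is_const_of_deriv_eq_zero (fun ζ => (h1 ζ).differentiableAt)
      (fun ζ => (h1 ζ).deriv) ζ 0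
    simp only [h0, logMGF_zero, Pi.zero_apply, zero_mul, sub_zero] at h2
    linarith
  funext ζ
  refine (SolvesLogEq.unique (η := -((h ζ M.x₀ - M.logMGF (M.condMean (h ζ)) M.x₀) -
    ζ * M.U M.x₀)) (fun x => ?_) (M.solvesLogEq_relValue ζ) (x₀ := M.x₀)
    (by rw [hx₀, relValue_x₀])).1
  have := hconst ζ x
  simp only [Pi.smul_apply, smul_eq_mul]
  linarith

/-! ### The Bellman operator -/

theorem relEntropy_eq_of_eq_Ph {R : Matrix (Xu × Xn) Xu ℝ} (hR : IsKernel R) {h : Xu × Xn → ℝ}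
    {x : Xu × Xn} (hx : M.P R x = M.Ph h x) :
    relEntropy (M.P R x) (M.P₀ x) =
      ((∑ x', M.P R x x' * h x' - M.logMGF (M.condMean h) x : ℝ) : EReal) := by
  rw [← sum_P_mul_condMean]
  rcases relEntropy_gibbs (M.isKernel_P hR x) (M.isKernel_P₀ x) (M.condMean h x) with
    ⟨-, hne⟩ | ⟨r, hr, -, hiff⟩
  · exact (hne hx).elim
  · rw [hr, ← hiff.2 hx, logMGF]

theorem lt_relEntropy_of_ne_Ph {R : Matrix (Xu × Xn) Xu ℝ} (hR : IsKernel R) {h : Xu × Xn → ℝ}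
    {x : Xu × Xn} (hx : M.P R x ≠ M.Ph h x) :
    ((∑ x', M.P R x x' * h x' - M.logMGF (M.condMean h) x : ℝ) : EReal) <
      relEntropy (M.P R x) (M.P₀ x) := by
  rw [← sum_P_mul_condMean]
  rcases relEntropy_gibbs (M.isKernel_P hR x) (M.isKernel_P₀ x) (M.condMean h x) with
    ⟨htop, -⟩ | ⟨r, hr, hle, hiff⟩
  · rw [htop]
    exact EReal.coe_lt_top _
  · rw [hr, EReal.coe_lt_coe_iff]
    exact lt_of_le_of_ne hle fun h => hx (hiff.1 h)

theorem le_relEntropy {R : Matrix (Xu × Xn) Xu ℝ} (hR : IsKernel R) (h : Xu × Xn → ℝ)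
    (x : Xu × Xn) :
    ((∑ x', M.P R x x' * h x' - M.logMGF (M.condMean h) x : ℝ) : EReal) ≤
      relEntropy (M.P R x) (M.P₀ x) := by
  by_cases hx : M.P R x = M.Ph h x
  · exact (M.relEntropy_eq_of_eq_Ph hR hx).ge
  · exact (M.lt_relEntropy_of_ne_Ph hR hx).le

theorem bellman_eq {R : Matrix (Xu × Xn) Xu ℝ} (hR : IsKernel R) (ζ : ℝ) {h : Xu × Xn → ℝ}
    {x : Xu × Xn} (hx : M.P R x = M.Ph h x) :
    M.bellman ζ h x R = ((ζ * M.U x + M.logMGF (M.condMean h) x : ℝ) : EReal) := by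
  rw [bellman, reward, M.relEntropy_eq_of_eq_Ph hR hx]
  norm_cast
  ring

theorem bellman_lt {R : Matrix (Xu × Xn) Xu ℝ} (hR : IsKernel R) (ζ : ℝ) {h : Xu × Xn → ℝ}
    {x : Xu × Xn} (hx : M.P R x ≠ M.Ph h x) :
    M.bellman ζ h x R < ((ζ * M.U x + M.logMGF (M.condMean h) x : ℝ) : EReal) := by
  have h1 := M.lt_relEntropy_of_ne_Ph hR hx
  rw [bellman, reward]
  revert h1
  induction relEntropy (M.P R x) (M.P₀ x) with
  | bot => exact fun h1 => absurd h1 not_lt_bot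
  -- Infinite relative entropy makes the Bellman value `⊥`.
  | top =>
    intro _
    rw [EReal.sub_top, EReal.bot_add]
    exact EReal.bot_lt_coe _
  | coe r =>
    intro h1
    norm_cast at h1 ⊢
    linarith

theorem isGreatest_bellman (ζ : ℝ) (h : Xu × Xn → ℝ) (x : Xu × Xn) :
    IsGreatest (M.bellman ζ h x '' {R | IsKernel R})
      ((ζ * M.U x + M.logMGF (M.condMean h) x : ℝ) : EReal) := by
  refine ⟨⟨M.tiltRule h, M.isKernel_tiltRule h,
    M.bellman_eq (M.isKernel_tiltRule h) ζ (congrFun (M.P_tiltRule h) x)⟩, ?_⟩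
  rintro _ ⟨R, hR, rfl⟩
  by_cases hx : M.P R x = M.Ph h x
  · exact (M.bellman_eq hR ζ hx).le
  · exact (M.bellman_lt hR ζ hx).le

theorem solvesAROE_iff (ζ : ℝ) (h : Xu × Xn → ℝ) (η : ℝ) :
    M.SolvesAROE ζ h η ↔ M.SolvesLogEq (ζ • M.U) h η := by
  refine forall_congr' fun x => ⟨fun H => ?_, fun H => ?_⟩
  · have := (M.isGreatest_bellman ζ h x).unique H
    exact_mod_cast this
  · rw [← H]
    exact M.isGreatest_bellman ζ h x

theorem isMaxOn_bellman_iff (ζ : ℝ) (h : Xu × Xn → ℝ) {R : Matrix (Xu × Xn) Xu ℝ}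
    (hR : IsKernel R) :
    (∀ x, IsMaxOn (M.bellman ζ h x) {R' | IsKernel R'} R) ↔ M.P R = M.Ph h := by
  constructor
  · intro H
    funext x
    by_contra hx
    have h1 := M.bellman_lt hR ζ hx
    have h2 : M.bellman ζ h x (M.tiltRule h) ≤ M.bellman ζ h x R :=
      H x (M.isKernel_tiltRule h)
    rw [M.bellman_eq (M.isKernel_tiltRule h) ζ (congrFun (M.P_tiltRule h) x)] at h2
    exact absurd h1 h2.not_gt
  · intro H x R' hR'
    rw [Set.mem_ofPred_eq, M.bellman_eq hR ζ (congrFun H x)]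
    exact (M.isGreatest_bellman ζ h x).2 ⟨R', hR', rfl⟩

/-- The Gibbs bound, rewritten with the optimality equation so that the right side is `η` plus the
expected decrease of `h`. -/
theorem reward_le {ζ : ℝ} {h : Xu × Xn → ℝ} {η : ℝ} (H : M.SolvesLogEq (ζ • M.U) h η)
    {R : Matrix (Xu × Xn) Xu ℝ} (hR : IsKernel R) (x : Xu × Xn) :
    M.reward ζ x R ≤ ((h x + η - ∑ x', M.P R x x' * h x' : ℝ) : EReal) := by
  have h1 : h x + η - ∑ x', M.P R x x' * h x' =
      ζ * M.U x - (∑ x', M.P R x x' * h x' - M.logMGF (M.condMean h) x) := by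
    rw [← H x, Pi.smul_apply, smul_eq_mul]
    ring
  rw [h1, EReal.coe_sub]
  exact EReal.sub_le_sub le_rfl (M.le_relEntropy hR h x)

theorem reward_eq {ζ : ℝ} {h : Xu × Xn → ℝ} {η : ℝ} (H : M.SolvesLogEq (ζ • M.U) h η)
    {R : Matrix (Xu × Xn) Xu ℝ} (hR : IsKernel R) {x : Xu × Xn} (hx : M.P R x = M.Ph h x) :
    M.reward ζ x R = ((h x + η - ∑ x', M.P R x x' * h x' : ℝ) : EReal) := by
  have h1 : h x + η - ∑ x', M.P R x x' * h x' =
      ζ * M.U x - (∑ x', M.P R x x' * h x' - M.logMGF (M.condMean h) x) := by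
    rw [← H x, Pi.smul_apply, smul_eq_mul]
    ring
  rw [h1, EReal.coe_sub, reward, M.relEntropy_eq_of_eq_Ph hR hx]

/-! ### Verification over all policies -/

theorem pathProb_nonneg (φ : Policy Xu Xn) (x : Xu × Xn) :
    ∀ (t : ℕ) (ω : Fin (t + 1) → Xu × Xn), 0 ≤ M.pathProb φ x t ω
  | 0, ω => by
    rw [pathProb]
    split_ifs <;> norm_num
  | t + 1, ω => mul_nonneg (pathProb_nonneg φ x t _)
      ((M.isKernel_P (φ.kernel_rule t _)).nonneg _ _)

/-- The expectation of `f (X(t))` under the policy `φ`. -/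
def stateExp (φ : Policy Xu Xn) (x : Xu × Xn) (t : ℕ) (f : Xu × Xn → ℝ) : ℝ :=
  ∑ ω : Fin (t + 1) → Xu × Xn, M.pathProb φ x t ω * f (ω (Fin.last t))

theorem stateExp_zero (φ : Policy Xu Xn) (x : Xu × Xn) (f : Xu × Xn → ℝ) :
    M.stateExp φ x 0 f = f x := by
  rw [stateExp, ← (Equiv.funUnique (Fin 1) (Xu × Xn)).symm.sum_comp]
  simp [pathProb]

theorem stateExp_succ (φ : Policy Xu Xn) (x : Xu × Xn) (t : ℕ) (f : Xu × Xn → ℝ) :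
    M.stateExp φ x (t + 1) f = ∑ ω : Fin (t + 1) → Xu × Xn, M.pathProb φ x t ω *
      ∑ x', M.P (φ.rule t ω) (ω (Fin.last t)) x' * f x' := by
  rw [stateExp, ← (Fin.snocEquiv fun _ : Fin (t + 2) => Xu × Xn).sum_comp,
    Fintype.sum_prod_type, Finset.sum_comm]
  refine Finset.sum_congr rfl fun ω _ => ?_
  rw [Finset.mul_sum]
  refine Finset.sum_congr rfl fun x' _ => ?_
  have hinit : Fin.init ((Fin.snocEquiv fun _ : Fin (t + 2) => Xu × Xn) (x', ω)) = ω :=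
    Fin.init_snoc _ _
  rw [pathProb, hinit]
  simp only [Fin.snocEquiv_apply, Fin.snoc_castSucc, Fin.snoc_last]
  ring

theorem sum_pathProb (φ : Policy Xu Xn) (x : Xu × Xn) (t : ℕ) :
    ∑ ω, M.pathProb φ x t ω = 1 := by
  have h : M.stateExp φ x t (fun _ => 1) = 1 := by
    induction t with
    | zero => exact M.stateExp_zero φ x _
    | succ t ih =>
      rw [stateExp_succ]
      refine Eq.trans ?_ ih
      refine Finset.sum_congr rfl fun ω _ => ?_
      rw [(M.isKernel_P (φ.kernel_rule t ω)).sum_mul_const]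
  simpa [stateExp] using h

theorem abs_stateExp_le (φ : Policy Xu Xn) (x : Xu × Xn) (t : ℕ) (f : Xu × Xn → ℝ) :
    |M.stateExp φ x t f| ≤ ‖f‖ := by
  calc |M.stateExp φ x t f| ≤ ∑ ω, |M.pathProb φ x t ω * f (ω (Fin.last t))| :=
        Finset.abs_sum_le_sum_abs _ _
    _ ≤ ∑ ω, M.pathProb φ x t ω * ‖f‖ := by
        refine Finset.sum_le_sum fun ω _ => ?_
        rw [abs_mul, abs_of_nonneg (M.pathProb_nonneg φ x t ω)]
        exact mul_le_mul_of_nonneg_left (norm_le_pi_norm f _) (M.pathProb_nonneg φ x t ω)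
    _ = ‖f‖ := by rw [← Finset.sum_mul, sum_pathProb, one_mul]

theorem sum_pathProb_mul_eq (φ : Policy Xu Xn) (x : Xu × Xn) (t : ℕ) (h : Xu × Xn → ℝ) (η : ℝ) :
    ∑ ω, M.pathProb φ x t ω * (h (ω (Fin.last t)) + η -
      ∑ x', M.P (φ.rule t ω) (ω (Fin.last t)) x' * h x') =
    η + M.stateExp φ x t h - M.stateExp φ x (t + 1) h := by
  simp_rw [mul_sub, mul_add, Finset.sum_sub_distrib, Finset.sum_add_distrib, ← Finset.sum_mul]
  rw [sum_pathProb, ← stateExp_succ, ← stateExp]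
  ring

theorem sum_range_telescope (φ : Policy Xu Xn) (x : Xu × Xn) (h : Xu × Xn → ℝ) (η : ℝ) (T : ℕ) :
    ∑ t ∈ Finset.range T, (η + M.stateExp φ x t h - M.stateExp φ x (t + 1) h) =
      T * η + (h x - M.stateExp φ x T h) := by
  simp_rw [add_sub_assoc, Finset.sum_add_distrib]
  rw [Finset.sum_range_sub', stateExp_zero]
  simp

/-- The telescoped sum is `T η` plus a boundary term bounded by `2‖h‖`. -/
theorem tendsto_average (φ : Policy Xu Xn) (x : Xu × Xn) (h : Xu × Xn → ℝ) (η : ℝ) :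
    Filter.Tendsto (fun T : ℕ => ((1 / (T : ℝ) * ∑ t ∈ Finset.range T,
      (η + M.stateExp φ x t h - M.stateExp φ x (t + 1) h) : ℝ) : EReal)) Filter.atTop
      (nhds (η : EReal)) := by
  refine (continuous_coe_real_ereal.tendsto η).comp ?_
  have h1 : Filter.Tendsto (fun T : ℕ => 1 / (T : ℝ) * (h x - M.stateExp φ x T h)) Filter.atTop
      (nhds 0) := by
    refine tendsto_one_div_atTop_nhds_zero_nat.zero_mul_isBoundedUnder_le ?_
    refine ⟨‖h‖ + ‖h‖, Filter.eventually_map.2 (.of_forall fun T => ?_)⟩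
    exact (norm_sub_le _ _).trans (add_le_add (norm_le_pi_norm h x) (M.abs_stateExp_le φ x T h))
  have h2 := h1.const_add η
  rw [add_zero] at h2
  refine h2.congr' ?_
  filter_upwards [Filter.eventually_gt_atTop 0] with T hT
  have hT' : (T : ℝ) ≠ 0 := by exact_mod_cast hT.ne'
  rw [sum_range_telescope, mul_add, ← mul_assoc, one_div_mul_cancel hT', one_mul]

theorem averageReward_le {ζ : ℝ} {h : Xu × Xn → ℝ} {η : ℝ} (H : M.SolvesLogEq (ζ • M.U) h η)
    (φ : Policy Xu Xn) (x : Xu × Xn) : M.averageReward ζ φ x ≤ η := by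
  rw [← (M.tendsto_average φ x h η).liminf_eq, averageReward]
  refine Filter.liminf_le_liminf (.of_forall fun T => ?_)
  rw [EReal.coe_mul, coe_sum]
  refine mul_le_mul_of_nonneg_left (Finset.sum_le_sum fun t _ => ?_)
    (EReal.coe_nonneg.2 (by positivity))
  rw [← sum_pathProb_mul_eq, coe_sum, expectedReward]
  refine Finset.sum_le_sum fun ω _ => ?_
  rw [EReal.coe_mul]
  exact mul_le_mul_of_nonneg_left (M.reward_le H (φ.kernel_rule t ω) _)
    (EReal.coe_nonneg.2 (M.pathProb_nonneg φ x t ω))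

theorem averageReward_stationary {ζ : ℝ} {h : Xu × Xn → ℝ} {η : ℝ}
    (H : M.SolvesLogEq (ζ • M.U) h η) {R : Matrix (Xu × Xn) Xu ℝ} (hR : IsKernel R)
    (hRh : M.P R = M.Ph h) (x : Xu × Xn) :
    M.averageReward ζ (Policy.stationary R hR) x = η := by
  rw [← (M.tendsto_average (Policy.stationary R hR) x h η).liminf_eq, averageReward]
  congr 1
  funext T
  rw [EReal.coe_mul, coe_sum]
  refine congrArg _ (Finset.sum_congr rfl fun t _ => ?_)
  rw [← sum_pathProb_mul_eq, coe_sum, expectedReward]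
  refine Finset.sum_congr rfl fun ω _ => ?_
  rw [EReal.coe_mul, Policy.stationary, M.reward_eq H hR (congrFun hRh _)]

theorem isOptimalReward {ζ : ℝ} {h : Xu × Xn → ℝ} {η : ℝ} (H : M.SolvesLogEq (ζ • M.U) h η) :
    M.IsOptimalReward ζ η := fun x =>
  ⟨⟨_, M.averageReward_stationary H (M.isKernel_tiltRule h) (M.P_tiltRule h) x⟩, by
    rintro _ ⟨φ, rfl⟩
    exact M.averageReward_le H φ x⟩

theorem isRelativeValueFunction_iff (ζ : ℝ) (f : Xu × Xn → ℝ) :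
    M.IsRelativeValueFunction ζ f ↔ f = M.relValue ζ := by
  constructor
  · rintro ⟨h0, η, -, hη⟩
    exact (((M.solvesAROE_iff ζ f η).1 hη).unique (M.solvesLogEq_relValue ζ) (x₀ := M.x₀)
      (by rw [h0, relValue_x₀])).1
  · rintro rfl
    exact ⟨M.relValue_x₀ ζ, _, M.isOptimalReward (M.solvesLogEq_relValue ζ),
      (M.solvesAROE_iff _ _ _).2 (M.solvesLogEq_relValue ζ)⟩

/-! ### The optimal transition matrix -/

/-- The real lower bound `c` is left free so that it can be raised at one state when strictness is
needed. -/
theorem sub_dvRate_le {π c : Xu × Xn → ℝ} {P : Matrix (Xu × Xn) (Xu × Xn) ℝ}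
    (hπ : ∀ x, 0 ≤ π x) (hc : ∀ x, (c x : EReal) ≤ relEntropy (P x) (M.P₀ x)) (v : ℝ) :
    (v : EReal) - M.dvRate π P ≤ ((v - ∑ x, π x * c x : ℝ) : EReal) := by
  rw [EReal.coe_sub, coe_sum, dvRate]
  refine EReal.sub_le_sub le_rfl (Finset.sum_le_sum fun x _ => ?_)
  rw [EReal.coe_mul]
  exact mul_le_mul_of_nonneg_left (hc x) (EReal.coe_nonneg.2 (hπ x))

/-- Replacing each entropy by its Gibbs lower bound makes the objective equal `η` at every invariant
pair, as `π P h = π h`. -/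
theorem sub_sum_mul_eq {ζ : ℝ} {h : Xu × Xn → ℝ} {η : ℝ} (H : M.SolvesLogEq (ζ • M.U) h η)
    {π : Xu × Xn → ℝ} {P : Matrix (Xu × Xn) (Xu × Xn) ℝ} (hπ : IsInvariantPmf π P) :
    ζ * ∑ x, π x * M.U x -
      ∑ x, π x * (∑ x', P x x' * h x' - M.logMGF (M.condMean h) x) = η := by
  have h1 : ∀ x, π x * (∑ x', P x x' * h x' - M.logMGF (M.condMean h) x) =
      π x * ∑ x', P x x' * h x' - π x * h x + ζ * (π x * M.U x) - π x * η := fun x => by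
    have := H x
    rw [Pi.smul_apply, smul_eq_mul] at this
    linear_combination (-π x) * this
  simp_rw [h1, Finset.sum_sub_distrib, Finset.sum_add_distrib, Finset.sum_sub_distrib,
    ← Finset.mul_sum, ← Finset.sum_mul]
  rw [sum_mulVec_of_invariant hπ.2, hπ.1.2]
  ring

theorem sub_dvRate_le_of_feasible {ζ : ℝ} {h : Xu × Xn → ℝ} {η : ℝ}
    (H : M.SolvesLogEq (ζ • M.U) h η) {π : Xu × Xn → ℝ} {P : Matrix (Xu × Xn) (Xu × Xn) ℝ}
    (hf : (π, P) ∈ M.feasible) :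
    ((ζ * ∑ x, π x * M.U x : ℝ) : EReal) - M.dvRate π P ≤ η := by
  obtain ⟨⟨R, hR, rfl : P = _⟩, hπ⟩ := hf
  rw [← M.sub_sum_mul_eq H hπ]
  exact M.sub_dvRate_le hπ.1.1 (M.le_relEntropy hR h) _

theorem sub_dvRate_lt_of_feasible {ζ : ℝ} {h : Xu × Xn → ℝ} {η : ℝ}
    (H : M.SolvesLogEq (ζ • M.U) h η) {π : Xu × Xn → ℝ} {P : Matrix (Xu × Xn) (Xu × Xn) ℝ}
    (hf : (π, P) ∈ M.feasible) {x : Xu × Xn} (hx : 0 < π x) (hne : P x ≠ M.Ph h x) :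
    ((ζ * ∑ x, π x * M.U x : ℝ) : EReal) - M.dvRate π P < η := by
  obtain ⟨⟨R, hR, rfl : P = _⟩, hπ⟩ := hf
  -- The entropy at `x` may be infinite, so a real number strictly above the Gibbs bound stands in
  -- for it.
  obtain ⟨c, hc, hc'⟩ := EReal.lt_iff_exists_real_btwn.1 (M.lt_relEntropy_of_ne_Ph hR hne)
  rw [EReal.coe_lt_coe_iff] at hc
  set c₀ : Xu × Xn → ℝ := fun x => ∑ x', M.P R x x' * h x' - M.logMGF (M.condMean h) x with hc₀
  refine (M.sub_dvRate_le hπ.1.1 (c := Function.update c₀ x c) (fun y => ?_) _).trans_lt ?_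
  · rcases eq_or_ne y x with rfl | hy
    · simpa using hc'.le
    · rw [Function.update_of_ne hy]
      exact M.le_relEntropy hR h y
  · rw [EReal.coe_lt_coe_iff, ← M.sub_sum_mul_eq H hπ]
    refine sub_lt_sub_left (Finset.sum_lt_sum (fun y _ => ?_) ⟨x, Finset.mem_univ _, ?_⟩) _
    · rcases eq_or_ne y x with rfl | hy
      · simpa using mul_le_mul_of_nonneg_left hc.le hx.le
      · simp [hy, hc₀]
    · simpa using mul_lt_mul_of_pos_left hc hx

theorem sub_dvRate_Ph {ζ : ℝ} {h : Xu × Xn → ℝ} {η : ℝ} (H : M.SolvesLogEq (ζ • M.U) h η)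
    {π : Xu × Xn → ℝ} (hπ : IsInvariantPmf π (M.Ph h)) :
    ((ζ * ∑ x, π x * M.U x : ℝ) : EReal) - M.dvRate π (M.Ph h) = η := by
  rw [← M.sub_sum_mul_eq H hπ, EReal.coe_sub, coe_sum, dvRate]
  congr 1
  refine Finset.sum_congr rfl fun x _ => ?_
  rw [EReal.coe_mul, ← M.P_tiltRule h, M.relEntropy_eq_of_eq_Ph (M.isKernel_tiltRule h)
    (congrFun (M.P_tiltRule h) x)]

theorem isOptimalTransition_iff {ζ : ℝ} {h : Xu × Xn → ℝ} {η : ℝ}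
    (H : M.SolvesLogEq (ζ • M.U) h η) (P : Matrix (Xu × Xn) (Xu × Xn) ℝ) :
    M.IsOptimalTransition ζ P ↔ P = M.Ph h := by
  have : Nonempty (Xu × Xn) := ⟨M.x₀⟩
  obtain ⟨ϖ, hϖ, -⟩ := existsUnique_invariantPmf (M.isKernel_Ph h) (M.isIrreducible_Ph h)
  have hfeas : (ϖ, M.Ph h) ∈ M.feasible :=
    ⟨⟨M.tiltRule h, M.isKernel_tiltRule h, (M.P_tiltRule h).symm⟩, hϖ⟩
  constructor
  · rintro ⟨π, hf, hmax⟩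
    have h1 := hmax hfeas
    simp only [Set.mem_ofPred_eq] at h1
    rw [M.sub_dvRate_Ph H hϖ] at h1
    have h2 : ∀ x, 0 < π x → P x = M.Ph h x := fun x hx => by
      by_contra hne
      exact absurd (M.sub_dvRate_lt_of_feasible H hf hx hne) h1.not_gt
    have hπ : IsInvariantPmf π P := hf.2
    -- Optimality fixes `P` only where `π > 0`. That already makes `π` invariant for the irreducible
    -- `P_h`, so `π` is positive everywhere and no row is left free.
    have hinv : IsInvariantPmf π (M.Ph h) := by
      refine ⟨hπ.1, ?_⟩
      conv_rhs => rw [← hπ.2]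
      funext y
      refine Finset.sum_congr rfl fun x _ => ?_
      rcases (hπ.1.1 x).eq_or_lt with h0 | hpos
      · simp [← h0]
      · exact congrArg (π x * ·) (congrFun (h2 x hpos) y).symm
    exact funext fun x => h2 x (hinv.pos (M.isKernel_Ph h) (M.isIrreducible_Ph h) x)
  · rintro rfl
    refine ⟨ϖ, hfeas, fun p hp => ?_⟩
    rw [Set.mem_ofPred_eq]
    exact (M.sub_dvRate_le_of_feasible H hp).trans (M.sub_dvRate_Ph H hϖ).ge

end Model

end KLMDP

theorem theoremt {Xu Xn : Type*} [Fintype Xu] [Fintype Xn] [DecidableEq Xu] [DecidableEq Xn]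
    (M : KLMDP.Model Xu Xn) :
    -- the vector field is well defined: each `P_g` lies in the domain of `ℋ°`
    (∀ g : Xu × Xn → ℝ, KLMDP.IsKernel (M.Ph g) ∧ (M.Ph g).IsIrreducible ∧
      KLMDP.IsAperiodic (M.Ph g) ∧ (∃! π, KLMDP.IsInvariantPmf π (M.Ph g)) ∧
      IsUnit (KLMDP.preFundamental (M.Ph g))) ∧
    -- the ODE has exactly one solution on `ℝ`
    ∃ h : ℝ → Xu × Xn → ℝ, M.SolvesODE h ∧ (∀ h', M.SolvesODE h' → h' = h) ∧
      ∀ ζ : ℝ,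
        -- `h ζ` is the relative value function
        (∀ f, M.IsRelativeValueFunction ζ f ↔ f = h ζ) ∧
        -- `P_{h ζ}` is the optimal transition matrix
        (∀ P, M.IsOptimalTransition ζ P ↔ P = M.Ph (h ζ)) ∧
        -- it is induced by the maximizer in the optimality equation, and by a stationary
        -- policy that attains the optimal average reward from every initial state
        (∀ R, KLMDP.IsKernel R →
          ((∀ x, IsMaxOn (M.bellman ζ (h ζ) x) {R' | KLMDP.IsKernel R'} R) ↔
            M.P R = M.Ph (h ζ))) ∧
        ∃ (R : Matrix (Xu × Xn) Xu ℝ) (hR : KLMDP.IsKernel R), M.P R = M.Ph (h ζ) ∧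
          ∀ x, ∀ η : ℝ, M.IsOptimalReward ζ η →
            M.averageReward ζ (KLMDP.Policy.stationary R hR) x = (η : EReal) := by
  have : Nonempty (Xu × Xn) := ⟨M.x₀⟩
  refine ⟨fun g => ⟨M.isKernel_Ph g, M.isIrreducible_Ph g, M.isAperiodic_Ph g,
    KLMDP.existsUnique_invariantPmf (M.isKernel_Ph g) (M.isIrreducible_Ph g),
    KLMDP.isUnit_preFundamental (M.isKernel_Ph g) (M.isIrreducible_Ph g)⟩,
    M.relValue, M.solvesODE_relValue, fun h' hh => M.eq_relValue_of_solvesODE hh, fun ζ =>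
    ⟨M.isRelativeValueFunction_iff ζ, M.isOptimalTransition_iff (M.solvesLogEq_relValue ζ),
      fun R hR => M.isMaxOn_bellman_iff ζ _ hR, M.tiltRule (M.relValue ζ),
      M.isKernel_tiltRule _, M.P_tiltRule _, fun x η hη => ?_⟩⟩
  rw [M.averageReward_stationary (M.solvesLogEq_relValue ζ) _ (M.P_tiltRule _)]
  exact (M.isOptimalReward (M.solvesLogEq_relValue ζ) x).unique (hη x)
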